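/- **Proposition 2.5.** Let $T$ be a complete first-order theory in a countable language $L$; below, $x$ is a single variable, $y$ a finite tuple of variables, possibly empty. We say that $T$ has *property (D)* if for every model $M$ of $T$, every $A\subseteq M$ and every consistent formula $\phi(x)\in L(A)$, there is a complete type $p\in S_x(A)$ containing $\phi(x)$ that is $A$-definable: for each $L$-formula $\psi(x;y)$ there is an $L(A)$-formula $d\psi(y)$ such that, for all tuples $a$ from $A$, $\psi(x;a)\in p$ if and only if $M\models d\psi(a)$. Then $T$ has property (D) in each of the following three cases. 1. $T$ has definable Skolem functions: for every $L$-formula $\phi(x;y)$ there is an $L$-formula which defines, in each model $M$ of $T$, the graph of a function $f:M^{|y|}\to M$ such that $M\models \forall y\,\bigl(\exists x\,\phi(x;y)\rightarrow\phi(f(y);y)\bigr)$. 2. $T$ is linearly ordered and dp-minimal. *Linearly ordered* means that $L$ contains a binary relation symbol $<$ which $T$ proves to be a (strict) linear order. *Dp-minimal* means: in every model of $T$, for every set $A$, every element $a$ and any two infinite sequences $I_0,I_1$ of finite tuples such that $I_0$ is indiscernible over $A\cup I_1$ and $I_1$ is indiscernible over $A\cup I_0$, at least one of $I_0,I_1$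 is indiscernible over $A\cup\{a\}$. 3. $T$ is an unpackable VC-minimal theory: there is a family $\Psi$ of $L$-formulas $\psi(x;y)$ (the length of $y$ may depend on $\psi$) such that the following hold in every model $M$ of $T$, where an instance of $\Psi$ is a set $\psi(M;b)$ with $\psi\in\Psi$ and $b$ a tuple from $M$, and a ball is a nonempty instance: - ($\Psi$ is directed) any two instances are comparable under inclusion or disjoint; - ($\Psi$ is generating) every subset of $M$ definable with parameters is a finite Boolean combination of instances; - ($\Psi$ is unpackable) no ball is the union of finitely many instances properly contained in it. -/

import Mathlib

namespace FirstOrder.Language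

universe u v w

variable {L : Language.{u, v}}

section Structures

variable (M : Type w) [L.Structure M]

/-- The formula `φ(x; a)` over `A` in the single variable `x`, obtained from an `L`-formula
`φ(x; y)` (`x` is variable `0`, `y` are the other ones) by putting a tuple `a` from `A` for `y`. -/
def plugParams {M : Type w} (A : Set M) {n : ℕ} (φ : L.Formula (Fin (n + 1))) (a : Fin n → A) :
    L[[A]].Formula (Fin 1) :=
  ((L.lhomWithConstants A).onFormula φ).subst
    (Fin.cons (Term.var (0 : Fin 1)) fun i => (L.con (a i)).term)

/-- `S_x(A)` for a single variable `x`: the complete types over a set `A` of parameters of `M`,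
that is, the complete `1`-types of the theory of `M` with names for the elements of `A`. -/
abbrev TypeOver (L : Language.{u, v}) {M : Type w} [L.Structure M] (A : Set M) :=
  (L[[A]].completeTheory M).CompleteType (Fin 1)

variable {M} in
/-- The formula `φ(x)` over `A` belongs to the type `p(x)` over `A`. -/
def TypeOver.Contains {A : Set M} (p : TypeOver L A) (φ : L[[A]].Formula (Fin 1)) : Prop :=
  Formula.equivSentence φ ∈ p

variable {M} in
/-- The type `p` over `A` is `A`-definable: for every `L`-formula `φ(x; y)` there is a formula
`dφ(y)` over `A` such that, for all tuples `a` from `A`, `φ(x; a) ∈ p` iff `dφ(a)` holds. -/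
def TypeOver.IsDefinable {A : Set M} (p : TypeOver L A) : Prop :=
  ∀ (n : ℕ) (φ : L.Formula (Fin (n + 1))), ∃ dφ : L[[A]].Formula (Fin n),
    ∀ a : Fin n → A, p.Contains (plugParams A φ a) ↔ dφ.Realize fun i => (a i : M)

/-- The sequence `(I j)_{j < ω}` of `m`-tuples is indiscernible over the set `B`. -/
def IsIndiscernible (L : Language.{u, v}) {M : Type w} [L.Structure M] (B : Set M) {m : ℕ}
    (I : ℕ → Fin m → M) : Prop :=
  ∀ (k : ℕ) (φ : L[[B]].Formula (Fin k × Fin m)) (i j : Fin k → ℕ),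
    StrictMono i → StrictMono j →
      ((φ.Realize fun q => I (i q.1) q.2) ↔ φ.Realize fun q => I (j q.1) q.2)

/-- The set of all coordinates of the tuples of the sequence `I`. -/
def seqSupport {M : Type w} {m : ℕ} (I : ℕ → Fin m → M) : Set M :=
  ⋃ j, Set.range (I j)

/-- The instances in `M` of the formulas `ψ(x; y)` of the family `Ψ` (`x` is variable `0`); these
are the balls of `M`, except that an instance may be empty. -/
def instances (Ψ : Set (Σ n : ℕ, L.Formula (Fin (n + 1)))) : Set (Set M) :=
  {B | ∃ ψ ∈ Ψ, ∃ b : Fin ψ.1 → M, B = {x | ψ.2.Realize (Fin.cons x b : Fin (ψ.1 + 1) → M)}}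

end Structures

namespace Theory

variable (T : L.Theory)

/-- Property (D): for all sets `A` of parameters (in a model of `T`) and all consistent formulas
`φ(x)` over `A` in a single variable, some `A`-definable complete type over `A` contains `φ`. -/
def HasPropertyD : Prop :=
  ∀ (M : ModelType.{u, v, max u v} T) (A : Set M) (φ : L[[A]].Formula (Fin 1)),
    (∃ x : M, φ.Realize fun _ => x) →
      ∃ p : TypeOver L A, p.Contains φ ∧ p.IsDefinable

/-- `T` has definable Skolem functions: for every formula `φ(x; y)`, some formula `ψ` without
parameters defines in each model the graph of a function `f` such that `φ(f(y); y)` holds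
whenever `φ(x; y)` holds for some `x`. -/
def HasDefinableSkolemFunctions : Prop :=
  ∀ (n : ℕ) (φ : L.Formula (Fin (n + 1))), ∃ ψ : L.Formula (Fin (n + 1)),
    ∀ M : ModelType.{u, v, max u v} T, ∃ f : (Fin n → M) → M,
      (∀ (y : Fin n → M) (x : M), ψ.Realize (Fin.cons x y : Fin (n + 1) → M) ↔ x = f y) ∧
      ∀ (y : Fin n → M) (x : M), φ.Realize (Fin.cons x y : Fin (n + 1) → M) →
        φ.Realize (Fin.cons (f y) y : Fin (n + 1) → M)

/-- `T` is linearly ordered: the language has a binary relation symbol that is interpreted by a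
(strict) linear order in every model of `T`. -/
def IsLinearlyOrdered : Prop :=
  ∃ lt : L.Relations 2, ∀ M : ModelType.{u, v, max u v} T,
    IsStrictTotalOrder M fun x y => Structure.RelMap lt ![x, y]

/-- `T` is dp-minimal: if `I₀` and `I₁` are infinite sequences of tuples, each of them
indiscernible over `A` and the other one, then for every singleton `a` one of them is
indiscernible over `A` and `a`. -/
def IsDPMinimal : Prop :=
  ∀ (M : ModelType.{u, v, max u v} T) (A : Set M) (a : M) (m₀ m₁ : ℕ)
    (I₀ : ℕ → Fin m₀ → M) (I₁ : ℕ → Fin m₁ → M),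
    IsIndiscernible L (A ∪ seqSupport I₁) I₀ → IsIndiscernible L (A ∪ seqSupport I₀) I₁ →
      IsIndiscernible L (A ∪ {a}) I₀ ∨ IsIndiscernible L (A ∪ {a}) I₁

/-- The family `Ψ` is directed: any two instances are comparable or disjoint. -/
def IsDirectedFamily (Ψ : Set (Σ n : ℕ, L.Formula (Fin (n + 1)))) : Prop :=
  ∀ M : ModelType.{u, v, max u v} T, ∀ B ∈ instances M Ψ, ∀ C ∈ instances M Ψ,
    B ⊆ C ∨ C ⊆ B ∨ Disjoint B C

/-- The family `Ψ` is generating: in models of `T`, every subset that is definable with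
parameters is a (finite) Boolean combination of instances of `Ψ`. -/
def IsGeneratingFamily (Ψ : Set (Σ n : ℕ, L.Formula (Fin (n + 1)))) : Prop :=
  ∀ (M : ModelType.{u, v, max u v} T) (X : Set M), Set.univ.Definable₁ L X →
    X ∈ BooleanSubalgebra.closure (instances M Ψ)

/-- The family `Ψ` is unpackable: no ball (that is, nonempty instance) is the union of finitely
many instances properly contained in it. -/
def IsUnpackableFamily (Ψ : Set (Σ n : ℕ, L.Formula (Fin (n + 1)))) : Prop :=
  ∀ M : ModelType.{u, v, max u v} T, ∀ B ∈ instances M Ψ, B.Nonempty →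
    ∀ 𝒞 ⊆ instances M Ψ, 𝒞.Finite → (∀ C ∈ 𝒞, C ⊂ B) → ⋃₀ 𝒞 ≠ B

/-- `T` is VC-minimal with an unpackable generating family. -/
def IsUnpackableVCMinimal : Prop :=
  ∃ Ψ : Set (Σ n : ℕ, L.Formula (Fin (n + 1))),
    T.IsDirectedFamily Ψ ∧ T.IsGeneratingFamily Ψ ∧ T.IsUnpackableFamily Ψ

end Theory

end FirstOrder.Language

namespace FirstOrder.Language

universe u v w

variable {L : Language.{u, v}} {M : Type w} [L.Structure M]

/-! ### Formulas with parameters and closure properties of definable sets -/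

section Parameters

/-! Types over `A` come from ultrafilters `V` on `M`: a formula is in the type when its solution set
is in `V`. Such a type is `A`-definable as soon as, for each formula `χ(x; y)`, some `A`-definable
relation on the tuples `y` preserves membership of the fibers in `V`, and finitely many tuples from
`A` reach all the others from `A` (`typeOfUltrafilter_isDefinable_of_finite`). Let `X` be the
solution set of the given formula.

Skolem functions: `X` contains an `A`-definable point; take its principal ultrafilter.

Ordered dp-minimal: if `X` has a greatest element, that point is `A`-definable. Otherwise let `V`
concentrate at the upper end of `X`; the relation is equality of germs there. Infinitely many germs
would give, in an ultrapower, two mutually indiscernible sequences, one of parameters of `χ` and one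
of points moving up `X`, and an element `c` between two of the points at which two fibers differ;
then neither sequence is indiscernible over `c` (`exists_finset_sameGerm`).

Unpackable VC-minimal: each ball has a generic type, which avoids all smaller balls
(`exists_generic`), and by compactness it is definable uniformly in the ball
(`exists_formula_isSmallIn`). Among the instances of a suitable finite set of formulas, those
maximal with generic type containing `X` are finite in number, at least one exists
(`maximal_isGenericBall`), and together they form an `A`-definable family. The generic type of any
one of them works: the relation says that two fibers lie in the generic types of the same maximal
balls. -/

theorem realize_plugParams {A : Set M} {n : ℕ} (χ : L.Formula (Fin (n + 1))) (a : Fin n → A)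
    (x : M) :
    (plugParams A χ a).Realize (fun _ => x) ↔
      χ.Realize (Fin.cons x fun i => (a i : M) : Fin (n + 1) → M) := by
  unfold plugParams Formula.Realize
  rw [BoundedFormula.realize_subst]
  change Formula.Realize _ _ ↔ _
  rw [LHom.realize_onFormula]
  have : (fun i : Fin (n + 1) =>
      ((Fin.cons (Term.var (0 : Fin 1)) fun i => (L.con (a i)).term :
        Fin (n + 1) → L[[A]].Term (Fin 1)) i).realize fun _ => x) =
      (Fin.cons x fun i => (a i : M) : Fin (n + 1) → M) := by
    funext i
    refine Fin.cases ?_ (fun i => ?_) i <;> simp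
  rw [this]
  rfl

/-- Every formula over `A` in one variable is an instance of an `L`-formula at a tuple
from `A`. -/
theorem exists_formula_realize_iff {A : Set M} (φ : L[[A]].Formula (Fin 1)) :
    ∃ (n : ℕ) (θ : L.Formula (Fin (n + 1))) (a : Fin n → A), ∀ x : M,
      φ.Realize (fun _ => x) ↔ θ.Realize (Fin.cons x fun i => (a i : M) : Fin (n + 1) → M) := by
  classical
  obtain ⟨χ, hχ⟩ := Set.definable_iff_exists_formula_sum.1 ⟨φ, rfl⟩
  let F : Finset A := χ.freeVarFinset.toLeft
  let e : F ≃ Fin F.card := F.equivFin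
  -- Only the finitely many parameters that occur in `χ` are kept; they are numbered after the
  -- variable `x`, which gets index `0`.
  let g : χ.freeVarFinset → Fin (F.card + 1) := fun s =>
    match s with
    | ⟨Sum.inl c, hc⟩ => (e ⟨c, Finset.mem_toLeft.2 hc⟩).succ
    | ⟨Sum.inr _, _⟩ => 0
  refine ⟨F.card, χ.restrictFreeVar g, fun i => (e.symm i : A), fun x => ?_⟩
  have h : φ.Realize (fun _ => x) ↔ χ.Realize (Sum.elim (↑) fun _ => x) :=
    Set.ext_iff.1 hχ fun _ => x
  rw [h]
  refine (BoundedFormula.realize_restrictFreeVar _ ?_).symm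
  rintro ⟨c | c, hc⟩
  · simp [g]
  · simp [g]

theorem definable_realize_comp (A : Set M) {α β : Type*} (χ : L.Formula β) (g : β → α) :
    A.Definable L {v : α → M | χ.Realize (v ∘ g)} := by
  refine Set.Definable.preimage_comp (s := {v | χ.Realize v}) g
    ⟨(L.lhomWithConstants A).onFormula χ, ?_⟩
  ext
  simp

theorem Definable.exists_unit {A : Set M} {α : Type*} {P : (α → M) → M → Prop}
    (h : A.Definable L {v : α ⊕ Unit → M | P (v ∘ Sum.inl) (v (Sum.inr ()))}) :
    A.Definable L {v : α → M | ∃ x, P v x} := by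
  refine (congrArg _ ?_).mp h.exists_of_finite
  ext v
  exact ⟨fun ⟨w, hw⟩ => ⟨w (), hw⟩, fun ⟨x, hx⟩ => ⟨fun _ => x, hx⟩⟩

theorem Definable.forall_unit {A : Set M} {α : Type*} {P : (α → M) → M → Prop}
    (h : A.Definable L {v : α ⊕ Unit → M | P (v ∘ Sum.inl) (v (Sum.inr ()))}) :
    A.Definable L {v : α → M | ∀ x, P v x} := by
  refine (congrArg _ ?_).mp h.forall_of_finite
  ext v
  exact ⟨fun H x => H fun _ => x, fun H w => H (w ())⟩

theorem Definable.imp {A : Set M} {α : Type*} {P Q : (α → M) → Prop}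
    (hP : A.Definable L {v | P v}) (hQ : A.Definable L {v | Q v}) :
    A.Definable L {v | P v → Q v} := by
  refine (congrArg _ ?_).mp (hP.compl.union hQ)
  ext v
  exact imp_iff_not_or.symm

theorem Definable.iff {A : Set M} {α : Type*} {P Q : (α → M) → Prop}
    (hP : A.Definable L {v | P v}) (hQ : A.Definable L {v | Q v}) :
    A.Definable L {v | P v ↔ Q v} := by
  refine (congrArg _ ?_).mp ((Definable.imp hP hQ).inter (Definable.imp hQ hP))
  ext v
  exact iff_iff_implies_and_implies.symm

theorem Definable.fix_params {A : Set M} {α β : Type*} {P : (α → M) → (β → M) → Prop}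
    (h : A.Definable L {v : α ⊕ β → M | P (v ∘ Sum.inl) (v ∘ Sum.inr)}) (f : α → A) :
    A.Definable L {v | P (fun i => (f i : M)) v} := by
  obtain ⟨ε, hε⟩ := h
  refine ⟨BoundedFormula.subst ε
    (Sum.elim (fun i => (L.con (f i)).term) fun i => Term.var i), ?_⟩
  ext v
  have h1 : P (fun i => (f i : M)) v ↔ ε.Realize (Sum.elim (fun i => (f i : M)) v) :=
    Set.ext_iff.1 hε (Sum.elim (fun i => (f i : M)) v)
  refine h1.trans (Iff.trans ?_ BoundedFormula.realize_subst.symm)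
  refine iff_of_eq (congrArg (fun t => BoundedFormula.Realize ε t default) ?_)
  funext i
  rcases i with i | i <;> simp

end Parameters

/-! ### Types from ultrafilters and a criterion for their definability -/

section UltrafilterType

variable [Nonempty M]

/-- The ultrapower of `M` by an ultrafilter on an index type. -/
abbrev Ultrapower {ι : Type*} (V : Ultrafilter ι) (M : Type*) : Type _ :=
  (V : Filter ι).Product fun _ => M

theorem ultrapower_model {ι : Type*} (V : Ultrafilter ι) (T : L.Theory) [M ⊨ T] :
    Ultrapower V M ⊨ T :=
  ⟨fun σ hσ => (Ultraproduct.sentence_realize σ).2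
    (Filter.Eventually.of_forall fun _ => T.realize_sentence_of_mem hσ)⟩

theorem ultrapower_nonempty {ι : Type*} (V : Ultrafilter ι) : Nonempty (Ultrapower V M) :=
  Ultraproduct.Product.instNonempty

/-- The type of the diagonal in the ultrapower of `M` by an ultrafilter on `M`. -/
noncomputable def diagonalType (V : Ultrafilter M) : (L.completeTheory M).CompleteType (Fin 1) :=
  @Theory.typeOf L (L.completeTheory M) (Fin 1) (Ultrapower V M) _ (ultrapower_nonempty V)
    (ultrapower_model V _) (fun _ => ((fun x => x : M → M) : Ultrapower V M))

theorem mem_diagonalType {V : Ultrafilter M} (φ : L.Formula (Fin 1)) :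
    Formula.equivSentence φ ∈ diagonalType (L := L) V ↔ {x : M | φ.Realize fun _ => x} ∈ V :=
  (@Theory.CompleteType.formula_mem_typeOf L (L.completeTheory M) (Fin 1) (Ultrapower V M) _
    (ultrapower_nonempty V) (ultrapower_model V _) _ φ).trans
    (Ultraproduct.realize_formula_cast (M := fun _ : M => M) φ fun _ x => x)

/-- The type over `A` of the formulas that hold at almost all points for an ultrafilter on
`M`. -/
noncomputable def typeOfUltrafilter (L : Language.{u, v}) {M : Type w} [L.Structure M] [Nonempty M]
    (A : Set M) (V : Ultrafilter M) : TypeOver L A :=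
  diagonalType (L := L[[A]]) V

theorem typeOfUltrafilter_contains {A : Set M} {V : Ultrafilter M}
    (φ : L[[A]].Formula (Fin 1)) :
    (typeOfUltrafilter L A V).Contains φ ↔ {x : M | φ.Realize fun _ => x} ∈ V :=
  mem_diagonalType φ

/-- The set of points satisfying an instance of a formula. -/
def fiber {n : ℕ} (χ : L.Formula (Fin (n + 1))) (a : Fin n → M) : Set M :=
  {x | χ.Realize (Fin.cons x a : Fin (n + 1) → M)}

theorem typeOfUltrafilter_isDefinable {A : Set M} {V : Ultrafilter M}
    (h : ∀ (n : ℕ) (χ : L.Formula (Fin (n + 1))), ∃ D : Set (Fin n → M), A.Definable L D ∧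
      ∀ a : Fin n → A, fiber χ (fun i => (a i : M)) ∈ V ↔ (fun i => (a i : M)) ∈ D) :
    (typeOfUltrafilter L A V).IsDefinable := by
  intro n χ
  obtain ⟨_, ⟨d, rfl⟩, hd⟩ := h n χ
  refine ⟨d, fun a => ?_⟩
  rw [typeOfUltrafilter_contains]
  simp_rw [realize_plugParams]
  exact hd a

/-- The type given by an ultrafilter is definable over `A` if, for each formula, membership of an
instance is respected by a relation that is definable over `A` and for which finitely many
tuples from `A` represent all of them. -/
theorem typeOfUltrafilter_isDefinable_of_finite {A : Set M} {V : Ultrafilter M}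
    (h : ∀ (n : ℕ) (χ : L.Formula (Fin (n + 1))), ∃ E : (Fin n → M) → (Fin n → M) → Prop,
      A.Definable L {v : Fin n ⊕ Fin n → M | E (v ∘ Sum.inl) (v ∘ Sum.inr)} ∧
      (∀ a b, E a b → (fiber χ a ∈ V ↔ fiber χ b ∈ V)) ∧
      ∃ F : Finset (Fin n → A), ∀ a : Fin n → A,
        ∃ f ∈ F, E (fun i => (f i : M)) fun i => (a i : M)) :
    (typeOfUltrafilter L A V).IsDefinable := by
  classical
  refine typeOfUltrafilter_isDefinable fun n χ => ?_
  obtain ⟨E, hE, hEV, F, hF⟩ := h n χ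
  -- The defining formula is the disjunction of `E(f, y)` over the representatives `f` whose fiber
  -- is in `V`.
  let G := F.filter fun f => fiber χ (fun i => (f i : M)) ∈ V
  refine ⟨⋃ f ∈ G, {v | E (fun i => (f i : M)) v},
    Set.definable_biUnion_finset (fun f => Definable.fix_params hE f) G, fun a => ?_⟩
  rw [Set.mem_iUnion₂]
  constructor
  · intro ha
    obtain ⟨f, hf, hfa⟩ := hF a
    exact ⟨f, Finset.mem_filter.2 ⟨hf, (hEV _ _ hfa).2 ha⟩, hfa⟩
  · rintro ⟨f, hf, hfa⟩
    exact (hEV _ _ hfa).1 (Finset.mem_filter.1 hf).2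

end UltrafilterType

/-! ### Iterated powers of an ultrafilter, on sequences -/

section SequenceUltrafilter

variable {ι : Type*}

/-- The iterated power `U ⊗ ⋯ ⊗ U` of an ultrafilter. -/
def iterPow (U : Ultrafilter ι) : (k : ℕ) → Ultrafilter (Fin k → ι)
  | 0 => pure Fin.elim0
  | k + 1 => U.bind fun x => (iterPow U k).map (Fin.cons x)

/-- Put an element in front of a sequence. -/
def seqCons (x : ι) (ω : ℕ → ι) : ℕ → ι
  | 0 => x
  | n + 1 => ω n

/-- The iterated power of an ultrafilter on the first entries of a sequence, followed by a
constant sequence. -/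
def iterSeq (U : Ultrafilter ι) (x₀ : ι) : ℕ → Ultrafilter (ℕ → ι)
  | 0 => pure fun _ => x₀
  | N + 1 => U.bind fun x => (iterSeq U x₀ N).map (seqCons x)

theorem mem_ultrafilter_bind {α β : Type*} (f : Ultrafilter α) (m : α → Ultrafilter β)
    (s : Set β) : s ∈ f.bind m ↔ {a | s ∈ m a} ∈ f :=
  Iff.rfl

/-- Induction on `N`, peeling off the first entry `x`. If all indices are positive, `x` is
irrelevant and the indices shift down by one; if `i 0 = 0`, then `x` is also the first factor of
`iterPow`, and the remaining indices are positive. -/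
theorem map_iterSeq (U : Ultrafilter ι) (x₀ : ι) (N k : ℕ) (i : Fin k → ℕ) (hi : StrictMono i)
    (hN : ∀ t, i t < N) : (iterSeq U x₀ N).map (fun ω => ω ∘ i) = iterPow U k := by
  induction N generalizing k with
  | zero =>
    cases k with
    | zero =>
      rw [iterSeq, Ultrafilter.map_pure]
      exact congrArg pure (Subsingleton.elim _ _)
    | succ k => exact absurd (hN 0) (Nat.not_lt_zero _)
  | succ N ih =>
    ext s
    rw [Ultrafilter.mem_map, iterSeq, mem_ultrafilter_bind]
    have key : ∀ (k : ℕ) (i : Fin k → ℕ), StrictMono i → (∀ t, i t < N + 1) → (∀ t, 0 < i t) →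
        ∀ (s : Set (Fin k → ι)) (x : ι),
          (fun ω => ω ∘ i) ⁻¹' s ∈ (iterSeq U x₀ N).map (seqCons x) ↔ s ∈ iterPow U k := by
      intro k i hi hN h0 s x
      rw [← ih k (fun t => i t - 1) (fun a b hab => by have := hi hab; have := h0 a; dsimp; omega)
        (fun t => by have := hN t; have := h0 t; omega), Ultrafilter.mem_map, Ultrafilter.mem_map]
      refine iff_of_eq (congrArg (· ∈ iterSeq U x₀ N) ?_)
      ext ω
      have : seqCons x ω ∘ i = ω ∘ fun t => i t - 1 := by
        funext t
        obtain ⟨m, hm⟩ := Nat.exists_eq_succ_of_ne_zero (h0 t).ne'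
        simp [hm, seqCons]
      simp only [Set.mem_preimage, this]
    by_cases h0 : ∀ t, 0 < i t
    · simp_rw [key k i hi hN h0 s]
      by_cases hs : s ∈ iterPow U k
      · simp only [hs, Set.ofPred_true, iff_true]
        exact Filter.univ_mem
      · simp [hs]
    · cases k with
      | zero => exact absurd (fun t => Fin.elim0 t) h0
      | succ k =>
        have hi0 : i 0 = 0 := by
          push Not at h0
          obtain ⟨t, ht⟩ := h0
          have := hi.monotone (Fin.zero_le t)
          omega
        have hpos : ∀ t : Fin k, 0 < i t.succ := fun t => by
          have := hi (Fin.succ_pos t)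
          omega
        rw [iterPow, mem_ultrafilter_bind]
        refine iff_of_eq (congrArg (· ∈ U) ?_)
        ext x
        change (fun ω => ω ∘ i) ⁻¹' s ∈ (iterSeq U x₀ N).map (seqCons x) ↔
          s ∈ (iterPow U k).map (Fin.cons x)
        rw [Ultrafilter.mem_map (f := iterPow U k),
          ← key k (fun t => i t.succ) (fun a b hab => hi (Fin.succ_lt_succ_iff.2 hab))
          (fun t => hN _) hpos _ x, Ultrafilter.mem_map, Ultrafilter.mem_map]
        refine iff_of_eq (congrArg (· ∈ iterSeq U x₀ N) ?_)
        ext ω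
        have : seqCons x ω ∘ i = Fin.cons x (seqCons x ω ∘ fun t => i t.succ) := by
          funext t
          refine Fin.cases ?_ (fun t => ?_) t
          · simp [hi0, seqCons]
          · simp
        simp only [Set.mem_preimage, this]

/-- For each ultrafilter `U` on `ι` there is an ultrafilter on the sequences in `ι` whose images
on increasing finite subsequences are the iterated powers of `U`. -/
theorem exists_seqUltrafilter (U : Ultrafilter ι) : ∃ W : Ultrafilter (ℕ → ι),
    ∀ (k : ℕ) (i : Fin k → ℕ), StrictMono i → W.map (fun ω => ω ∘ i) = iterPow U k := by
  obtain ⟨x₀⟩ : Nonempty ι := U.neBot.nonempty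
  -- The limit of `iterSeq U x₀ N` as `N` grows: for almost all `N`, the indices in `i` lie below
  -- `N`, out of reach of the constant tail.
  refine ⟨(Filter.hyperfilter ℕ).bind (iterSeq U x₀), fun k i hi => ?_⟩
  ext s
  have hev : ∀ᶠ N in (Filter.hyperfilter ℕ : Filter ℕ), ∀ t, i t < N := by
    refine Filter.hyperfilter_le_cofinite ?_
    rw [Nat.cofinite_eq_atTop]
    exact Filter.eventually_all.2 fun t => Filter.eventually_gt_atTop _
  rw [Ultrafilter.mem_map, mem_ultrafilter_bind]
  have h2 : ∀ᶠ N in (Filter.hyperfilter ℕ : Filter ℕ),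
      ((fun ω => ω ∘ i) ⁻¹' s ∈ iterSeq U x₀ N ↔ s ∈ iterPow U k) :=
    hev.mono fun N hN => by rw [← map_iterSeq U x₀ N k i hi hN, Ultrafilter.mem_map]
  refine (Filter.eventually_congr h2).trans ?_
  simp

theorem eventually_pair_of_map_eq {U : Ultrafilter ι} {W : Ultrafilter (ℕ → ι)}
    (hW : ∀ (k : ℕ) (i : Fin k → ℕ), StrictMono i → W.map (fun ω => ω ∘ i) = iterPow U k)
    {P : ι → ι → Prop} (hP : ∀ᶠ x in (U : Filter ι), ∀ᶠ y in (U : Filter ι), P x y) :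
    ∀ᶠ ω in (W : Filter (ℕ → ι)), P (ω 0) (ω 1) := by
  have h2 := hW 2 (fun t => t) (fun a b h => h)
  have h3 : {t : Fin 2 → ι | P (t 0) (t 1)} ∈ iterPow U 2 := hP
  rw [← h2] at h3
  exact h3

end SequenceUltrafilter

/-! ### Mutually indiscernible sequences in an ultrapower -/

section MutuallyIndiscernible

variable {L : Language.{u, v}} {M : Type w} [L.Structure M] [Nonempty M] {ι κ : Type*}

/-- The product `W₀ ⊗ W₁` of two ultrafilters. -/
def ultrafilterProd {α β : Type*} (W₀ : Ultrafilter α) (W₁ : Ultrafilter β) :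
    Ultrafilter (α × β) :=
  W₀.bind fun a => W₁.map (Prod.mk a)

theorem eventually_ultrafilterProd {α β : Type*} {W₀ : Ultrafilter α} {W₁ : Ultrafilter β}
    {P : α × β → Prop} : (∀ᶠ ω in (ultrafilterProd W₀ W₁ : Filter (α × β)), P ω) ↔
      ∀ᶠ a in (W₀ : Filter α), ∀ᶠ b in (W₁ : Filter β), P (a, b) :=
  Iff.rfl

/-- The element of an ultrapower given by a function. -/
def ultrapowerMk {Ω : Type*} (V : Ultrafilter Ω) (f : Ω → M) : Ultrapower V M :=
  (f : (V : Filter Ω).Product fun _ => M)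

theorem realize_ultrapowerMk {Ω : Type*} {V : Ultrafilter Ω} {β : Type*} (φ : L.Formula β)
    (x : β → Ω → M) : (φ.Realize fun i => ultrapowerMk V (x i)) ↔
      ∀ᶠ ω in (V : Filter Ω), φ.Realize fun i => x i ω :=
  Ultraproduct.realize_formula_cast (u := V) (M := fun _ : Ω => M) φ x

theorem exists_formula_realize_ultrapowerMk {Ω : Type*} {V : Ultrafilter Ω}
    {B : Set (Ultrapower V M)} {β : Type*} (φ : L[[B]].Formula β) (h : B → Ω → M)
    (hh : ∀ b : B, (b : Ultrapower V M) = ultrapowerMk V (h b)) :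
    ∃ χ : L.Formula (B ⊕ β), ∀ x : β → Ω → M, (φ.Realize fun i => ultrapowerMk V (x i)) ↔
      ∀ᶠ ω in (V : Filter Ω), χ.Realize (Sum.elim (fun b => h b ω) fun i => x i ω) := by
  obtain ⟨χ, hχ⟩ := Set.definable_iff_exists_formula_sum.1 ⟨φ, rfl⟩
  refine ⟨χ, fun x => ?_⟩
  have h1 : (φ.Realize fun i => ultrapowerMk V (x i)) ↔
      χ.Realize (Sum.elim (fun b : B => (b : Ultrapower V M)) fun i => ultrapowerMk V (x i)) :=
    Set.ext_iff.1 hχ fun i => ultrapowerMk V (x i)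
  have h2 : (Sum.elim (fun b : B => (b : Ultrapower V M)) fun i => ultrapowerMk V (x i)) =
      fun s => ultrapowerMk V (Sum.elim h x s) := by
    funext s
    rcases s with b | i
    · exact hh b
    · rfl
  rw [h1, h2, realize_ultrapowerMk]
  refine iff_of_eq (congrArg (fun P : Ω → Prop => ∀ᶠ ω in (V : Filter Ω), P ω) ?_)
  funext ω
  refine congrArg χ.Realize ?_
  funext s
  rcases s with b | i <;> rfl

variable {W₀ : Ultrafilter (ℕ → ι)} {W₁ : Ultrafilter (ℕ → κ)}

/-- The parameters depend on the second coordinate only. Once that coordinate is absorbed by `W₁`,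
the truth of a formula at increasing indices is a membership in `iterPow U k`, which does not
mention the indices. -/
theorem isIndiscernible_fst {U : Ultrafilter ι}
    (hW : ∀ (k : ℕ) (i : Fin k → ℕ), StrictMono i → W₀.map (fun ω => ω ∘ i) = iterPow U k)
    {m : ℕ} (g : ι → Fin m → M) (B : Set (Ultrapower (ultrafilterProd W₀ W₁) M))
    (hB : ∀ b ∈ B, ∃ h : (ℕ → κ) → M, b = ultrapowerMk _ fun ω => h ω.2) :
    IsIndiscernible L B fun j s => ultrapowerMk (ultrafilterProd W₀ W₁) fun ω => g (ω.1 j) s := by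
  intro k φ i j hi hj
  choose h hh using fun b : B => hB b b.2
  obtain ⟨χ, hχ⟩ := exists_formula_realize_ultrapowerMk φ (fun b ω => h b ω.2) hh
  have key : ∀ i : Fin k → ℕ, StrictMono i →
      ((φ.Realize fun q => ultrapowerMk (ultrafilterProd W₀ W₁) fun ω => g (ω.1 (i q.1)) q.2) ↔
        {t : Fin k → ι | ∀ᶠ ω in (W₁ : Filter (ℕ → κ)),
          χ.Realize (Sum.elim (fun b => h b ω) fun q => g (t q.1) q.2)} ∈ iterPow U k) := by
    intro i hi
    rw [hχ, eventually_ultrafilterProd, ← hW k i hi]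
    rfl
  exact (key i hi).trans (key j hj).symm

/-- The product of ultrafilters is not symmetric: here the parameters are fixed by the outer
quantifier `W₀`, and the membership in `iterPow U k` is tested inside it. -/
theorem isIndiscernible_snd {U : Ultrafilter κ}
    (hW : ∀ (k : ℕ) (i : Fin k → ℕ), StrictMono i → W₁.map (fun ω => ω ∘ i) = iterPow U k)
    {m : ℕ} (g : κ → Fin m → M) (B : Set (Ultrapower (ultrafilterProd W₀ W₁) M))
    (hB : ∀ b ∈ B, ∃ h : (ℕ → ι) → M, b = ultrapowerMk _ fun ω => h ω.1) :
    IsIndiscernible L B fun j s => ultrapowerMk (ultrafilterProd W₀ W₁) fun ω => g (ω.2 j) s := by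
  intro k φ i j hi hj
  choose h hh using fun b : B => hB b b.2
  obtain ⟨χ, hχ⟩ := exists_formula_realize_ultrapowerMk φ (fun b ω => h b ω.1) hh
  have key : ∀ i : Fin k → ℕ, StrictMono i →
      ((φ.Realize fun q => ultrapowerMk (ultrafilterProd W₀ W₁) fun ω => g (ω.2 (i q.1)) q.2) ↔
        ∀ᶠ ω in (W₀ : Filter (ℕ → ι)), {t : Fin k → κ |
          χ.Realize (Sum.elim (fun b => h b ω) fun q => g (t q.1) q.2)} ∈ iterPow U k) := by
    intro i hi
    rw [hχ, eventually_ultrafilterProd, ← hW k i hi]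
    rfl
  exact (key i hi).trans (key j hj).symm

end MutuallyIndiscernible

/-! ### Definable points and Skolem functions -/

section Points

variable {L : Language.{u, v}} {M : Type w} [L.Structure M]

theorem definable_fiber_comp {A : Set M} {α : Type*} {n : ℕ} (χ : L.Formula (Fin (n + 1)))
    (i : α) (g : Fin n → α) : A.Definable L {v : α → M | v i ∈ fiber χ (v ∘ g)} := by
  refine (congrArg _ ?_).mp (definable_realize_comp A χ (Fin.cons i g : Fin (n + 1) → α))
  ext v
  have : v ∘ (Fin.cons i g : Fin (n + 1) → α) = Fin.cons (v i) (v ∘ g) := by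
    funext t
    refine Fin.cases ?_ (fun t => ?_) t <;> simp
  simp only [Set.mem_ofPred_eq, this]
  rfl

theorem typeOfUltrafilter_pure_isDefinable [Nonempty M] {A : Set M} {m : M}
    (hm : A.Definable L {v : Fin 1 → M | v 0 = m}) :
    (typeOfUltrafilter L A (pure m)).IsDefinable := by
  refine typeOfUltrafilter_isDefinable fun n χ =>
    ⟨{y | ∃ x, x = m ∧ x ∈ fiber χ y}, ?_, fun a => ?_⟩
  · exact Definable.exists_unit ((hm.preimage_comp fun _ => Sum.inr ()).inter
      (definable_fiber_comp χ (Sum.inr ()) Sum.inl))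
  · simp

theorem Theory.HasDefinableSkolemFunctions.hasPropertyD {T : L.Theory}
    (h : T.HasDefinableSkolemFunctions) : T.HasPropertyD := by
  intro M A φ ⟨x, hx⟩
  obtain ⟨n, θ, a, hθ⟩ := exists_formula_realize_iff φ
  obtain ⟨ψ, hψ⟩ := h n θ
  obtain ⟨f, hf, hfθ⟩ := hψ M
  refine ⟨typeOfUltrafilter L A (pure (f fun i => a i)), ?_,
    typeOfUltrafilter_pure_isDefinable ?_⟩
  · rw [typeOfUltrafilter_contains]
    exact (hθ _).2 (hfθ _ x ((hθ x).1 hx))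
  · have h1 := Definable.fix_params (P := fun (y : Fin n → M) (v : Fin 1 → M) => v 0 ∈ fiber ψ y)
      (definable_fiber_comp (A := A) ψ (Sum.inr 0) Sum.inl) a
    refine (congrArg _ ?_).mp h1
    ext v
    exact hf _ _

end Points

/-! ### Linearly ordered dp-minimal theories -/

section Ordered

variable {L : Language.{u, v}} {T : L.Theory}

/-- Two sets have the same germ at the upper end of a set without greatest element. -/
def SameGerm {M : Type*} (r : M → M → Prop) (X S S' : Set M) : Prop :=
  ∃ c ∈ X, ∀ x ∈ X, r c x → (x ∈ S ↔ x ∈ S')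

/-- The filter of all neighbourhoods of the upper end of a nonempty set without greatest
element. -/
def upperEnd {M : Type*} (r : M → M → Prop) [IsStrictTotalOrder M r] (X : Set M)
    (hX : X.Nonempty) : Filter M where
  sets := {S | ∃ c ∈ X, ∀ x ∈ X, r c x → x ∈ S}
  univ_sets := hX.imp fun c hc => ⟨hc, fun _ _ _ => trivial⟩
  sets_of_superset := fun ⟨c, hc, h⟩ hst => ⟨c, hc, fun x hx hcx => hst (h x hx hcx)⟩
  inter_sets := by
    rintro S S' ⟨c, hc, h⟩ ⟨c', hc', h'⟩
    rcases trichotomous_of r c c' with hr | rfl | hr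
    · exact ⟨c', hc', fun x hx hx' => ⟨h x hx (trans_of r hr hx'), h' x hx hx'⟩⟩
    · exact ⟨c, hc, fun x hx hx' => ⟨h x hx hx', h' x hx hx'⟩⟩
    · exact ⟨c, hc, fun x hx hx' => ⟨h x hx hx', h' x hx (trans_of r hr hx')⟩⟩

theorem upperEnd_neBot {M : Type*} (r : M → M → Prop) [IsStrictTotalOrder M r] (X : Set M)
    (hX : X.Nonempty) (hmax : ∀ c ∈ X, ∃ x ∈ X, r c x) : (upperEnd r X hX).NeBot := by
  rw [Filter.neBot_iff, Ne, ← Filter.empty_mem_iff_bot]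
  rintro ⟨c, hc, h⟩
  obtain ⟨x, hx, hcx⟩ := hmax c hc
  exact h x hx hcx

theorem Theory.IsDPMinimal.exists_finset_sameGerm (hdp : T.IsDPMinimal)
    (M : Theory.ModelType.{u, v, max u v} T) (lt : L.Relations 2)
    [IsStrictTotalOrder M fun x y => Structure.RelMap lt ![x, y] ] {X : Set M} (hX : X.Nonempty)
    (hmax : ∀ c ∈ X, ∃ x ∈ X, Structure.RelMap lt ![c, x]) {n : ℕ}
    (χ : L.Formula (Fin (n + 1))) {β : Type*} (t : β → Fin n → M) :
    ∃ F : Finset β, ∀ a, ∃ f ∈ F,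
      SameGerm (fun x y => Structure.RelMap lt ![x, y]) X (fiber χ (t f)) (fiber χ (t a)) := by
  set r : M → M → Prop := fun x y => Structure.RelMap lt ![x, y] with hr
  by_contra! hcon
  -- If no finite set represents all germs, there is a sequence of tuples with pairwise different
  -- germs.
  obtain ⟨α', -, hα'⟩ := exists_seq_of_forall_finset_exists (fun _ => True)
    (fun f a => ¬ SameGerm r X (fiber χ (t f)) (fiber χ (t a)))
    fun F _ => (hcon F).imp fun a ha => ⟨trivial, ha⟩
  obtain ⟨α, hα⟩ : ∃ α : ℕ → Fin n → M,
      ∀ i j, i < j → ¬ SameGerm r X (fiber χ (α i)) (fiber χ (α j)) := ⟨fun i => t (α' i), hα'⟩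
  have := upperEnd_neBot r X hX hmax
  let U₁ : Ultrafilter M := Ultrafilter.of (upperEnd r X hX)
  have hU₁ : ∀ S ∈ upperEnd r X hX, S ∈ U₁ := fun S hS => Ultrafilter.of_le _ hS
  obtain ⟨W₀, hW₀⟩ := exists_seqUltrafilter (Filter.hyperfilter ℕ)
  obtain ⟨W₁, hW₁⟩ := exists_seqUltrafilter U₁
  let V := ultrafilterProd W₀ W₁
  have h0 : ∀ᶠ ω in (W₀ : Filter (ℕ → ℕ)), ω 0 < ω 1 := by
    refine eventually_pair_of_map_eq (P := fun x y => x < y) hW₀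
      (Filter.Eventually.of_forall fun x => ?_)
    refine Filter.hyperfilter_le_cofinite ?_
    rw [Nat.cofinite_eq_atTop]
    exact Filter.eventually_gt_atTop x
  -- For almost every `x` in `X`, the different germs provide a `c` in `X` above `x` at which the
  -- fibers disagree, and almost every `y` is above `c`.
  have hc : ∀ᶠ ω in (V : Filter ((ℕ → ℕ) × (ℕ → M))), ∃ c, r (ω.2 0) c ∧ r c (ω.2 1) ∧
      ¬ (c ∈ fiber χ (α (ω.1 0)) ↔ c ∈ fiber χ (α (ω.1 1))) := by
    rw [eventually_ultrafilterProd]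
    filter_upwards [h0] with ω hω
    refine eventually_pair_of_map_eq (P := fun x y => ∃ c, r x c ∧ r c y ∧
      ¬ (c ∈ fiber χ (α (ω 0)) ↔ c ∈ fiber χ (α (ω 1)))) hW₁ ?_
    obtain ⟨c₀, hc₀⟩ := hX
    have hXU : X ∈ U₁ := hU₁ _ ⟨c₀, hc₀, fun x hx _ => hx⟩
    filter_upwards [hXU] with x hx
    have h2 := hα _ _ hω
    simp only [SameGerm, not_exists, not_and, not_forall] at h2
    obtain ⟨c, hcX, hxc, hc⟩ := h2 x hx
    have h3 : {y | r c y} ∈ U₁ := hU₁ _ ⟨c, hcX, fun x _ h => h⟩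
    filter_upwards [h3] with y hy
    exact ⟨c, hxc, hy, hc⟩
  have : Nonempty (Ultrapower V M) := ultrapower_nonempty V
  have : Ultrapower V M ⊨ T := ultrapower_model V T
  classical
  -- The default value `ω.2 0` is taken only on a null set.
  let c : (ℕ → ℕ) × (ℕ → M) → M := fun ω => if h : ∃ c, r (ω.2 0) c ∧ r c (ω.2 1) ∧
      ¬ (c ∈ fiber χ (α (ω.1 0)) ↔ c ∈ fiber χ (α (ω.1 1))) then h.choose else ω.2 0
  replace hc : ∀ᶠ ω in (V : Filter ((ℕ → ℕ) × (ℕ → M))), r (ω.2 0) (c ω) ∧ r (c ω) (ω.2 1) ∧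
      ¬ (c ω ∈ fiber χ (α (ω.1 0)) ↔ c ω ∈ fiber χ (α (ω.1 1))) := by
    filter_upwards [hc] with ω hω
    simp only [c, dif_pos hω]
    exact hω.choose_spec
  let I₀ : ℕ → Fin n → Ultrapower V M := fun j s => ultrapowerMk V fun ω => α (ω.1 j) s
  let I₁ : ℕ → Fin 1 → Ultrapower V M := fun j _ => ultrapowerMk V fun ω => ω.2 j
  have hI₀ : IsIndiscernible L (∅ ∪ seqSupport I₁) I₀ := by
    refine isIndiscernible_fst hW₀ α _ fun b hb => ?_
    rw [Set.empty_union, seqSupport, Set.mem_iUnion] at hb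
    obtain ⟨j, s, rfl⟩ := hb
    exact ⟨fun ω => ω j, rfl⟩
  have hI₁ : IsIndiscernible L (∅ ∪ seqSupport I₀) I₁ := by
    refine isIndiscernible_snd hW₁ (fun x _ => x) _ fun b hb => ?_
    rw [Set.empty_union, seqSupport, Set.mem_iUnion] at hb
    obtain ⟨j, s, rfl⟩ := hb
    exact ⟨fun ω => α (ω j) s, rfl⟩
  let C : Ultrapower V M := ultrapowerMk V c
  have hmono : ∀ m : ℕ, StrictMono fun _ : Fin 1 => m := fun m a b hab =>
    absurd hab (by omega)
  have apply : ∀ {m : ℕ} (g : ℕ → Fin m → (ℕ → ℕ) × (ℕ → M) → M) (ψ : L.Formula (Fin (m + 1))),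
      IsIndiscernible L (∅ ∪ {C}) (fun j s => ultrapowerMk V (g j s)) →
      ((∀ᶠ ω in (V : Filter _), c ω ∈ fiber ψ fun s => g 0 s ω) ↔
        ∀ᶠ ω in (V : Filter _), c ω ∈ fiber ψ fun s => g 1 s ω) := by
    intro m g ψ hI
    have hCmem : C ∈ (∅ ∪ {C} : Set (Ultrapower V M)) := Or.inr rfl
    obtain ⟨φ, hφ⟩ := Definable.fix_params (A := (∅ ∪ {C} : Set (Ultrapower V M)))
      (P := fun (y : Fin 1 → Ultrapower V M) (v : Fin 1 × Fin m → Ultrapower V M) =>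
        y 0 ∈ fiber ψ fun s => v (0, s))
      (definable_fiber_comp ψ (Sum.inl 0) fun s => Sum.inr (0, s)) fun _ => ⟨C, hCmem⟩
    have key : ∀ j, (φ.Realize fun q : Fin 1 × Fin m => ultrapowerMk V (g j q.2)) ↔
        ∀ᶠ ω in (V : Filter _), c ω ∈ fiber ψ fun s => g j s ω := by
      intro j
      refine (Set.ext_iff.1 hφ fun q => ultrapowerMk V (g j q.2)).symm.trans ?_
      have : (Fin.cons C fun s => ultrapowerMk V (g j s) : Fin (m + 1) → Ultrapower V M) =
          fun i => ultrapowerMk V ((Fin.cons c (g j) : Fin (m + 1) → _ → M) i) := by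
        funext i
        refine Fin.cases ?_ (fun i => ?_) i <;> simp [C]
      simp only [Set.mem_ofPred_eq, fiber, this, realize_ultrapowerMk]
      refine Filter.eventually_congr (Filter.Eventually.of_forall fun ω => ?_)
      refine iff_of_eq (congrArg ψ.Realize ?_)
      funext i
      refine Fin.cases ?_ (fun i => ?_) i <;> simp
    rw [← key 0, ← key 1]
    exact hI 1 φ (fun _ => 0) (fun _ => 1) (hmono 0) (hmono 1)
  rcases hdp (Theory.ModelType.of T (Ultrapower V M)) ∅ C n 1 I₀ I₁ hI₀ hI₁ with h | h
  -- Indiscernibility of `I₀` over `C` makes `C` lie in both of the first two fibers or in neither,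
  -- against the choice of `c`.
  · have h1 := apply (fun j s ω => α (ω.1 j) s) χ h
    have h2 := apply (fun j s ω => α (ω.1 j) s) χ.not h
    have h2' : (∀ᶠ ω in (V : Filter _), ¬ c ω ∈ fiber χ (α (ω.1 0))) ↔
        ∀ᶠ ω in (V : Filter _), ¬ c ω ∈ fiber χ (α (ω.1 1)) := h2
    rcases V.eventually_or.1 (Filter.Eventually.of_forall fun ω =>
      em (c ω ∈ fiber χ (α (ω.1 0)))) with h3 | h3
    · obtain ⟨ω, ⟨ha, hb⟩, -, -, hn⟩ := ((h3.and (h1.1 h3)).and hc).exists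
      exact hn (iff_of_true ha hb)
    · obtain ⟨ω, ⟨ha, hb⟩, -, -, hn⟩ := ((h3.and (h2'.1 h3)).and hc).exists
      exact hn (iff_of_false ha hb)
  -- Here `C` lies below the second point of `I₁`, hence also below the first, whereas it was chosen
  -- above it.
  · have h1 := apply (fun j (_ : Fin 1) ω => ω.2 j) (lt.formula₂ (Term.var 0) (Term.var 1)) h
    simp only [fiber, Set.mem_ofPred_eq, Formula.realize_rel₂, Term.realize_var, Fin.cons_zero,
      Fin.cons_one] at h1
    have h2 := h1.2 (hc.mono fun ω hω => hω.2.1)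
    obtain ⟨ω, ha, hb, -⟩ := (h2.and hc).exists
    exact asymm_of r ha hb

theorem Theory.IsDPMinimal.hasPropertyD (hdp : T.IsDPMinimal) (hlin : T.IsLinearlyOrdered) :
    T.HasPropertyD := by
  intro M A φ hφ
  obtain ⟨lt, hlt⟩ := hlin
  have := hlt M
  set r : M → M → Prop := fun x y => Structure.RelMap lt ![x, y] with hr
  let X : Set M := {x | φ.Realize fun _ => x}
  have hXdef : A.Definable L {v : Fin 1 → M | v 0 ∈ X} := by
    refine ⟨φ, ?_⟩
    ext v
    have : v = fun _ => v 0 := funext fun i => congrArg v (Subsingleton.elim i 0)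
    rw [this]
    rfl
  have hXcomp : ∀ {α : Type} (i : α), A.Definable L {v : α → M | v i ∈ X} := fun i =>
    hXdef.preimage_comp fun _ => i
  have hrcomp : ∀ {α : Type} (i j : α), A.Definable L {v : α → M | r (v i) (v j)} := by
    intro α i j
    refine (congrArg _ ?_).mp (definable_realize_comp A
      (lt.formula₂ (Term.var (0 : Fin 2)) (Term.var 1)) ![i, j])
    ext v
    simp [hr]
  by_cases hmax : ∀ c ∈ X, ∃ x ∈ X, r c x
  · have := upperEnd_neBot r X hφ hmax
    let V : Ultrafilter M := Ultrafilter.of (upperEnd r X hφ)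
    have hV : ∀ S ∈ upperEnd r X hφ, S ∈ V := fun S hS => Ultrafilter.of_le _ hS
    refine ⟨typeOfUltrafilter L A V, ?_, typeOfUltrafilter_isDefinable_of_finite fun n χ =>
      ⟨fun a b => SameGerm r X (fiber χ a) (fiber χ b), ?_, ?_, ?_⟩⟩
    · rw [typeOfUltrafilter_contains]
      exact hV X (hφ.imp fun c hc => ⟨hc, fun x hx _ => hx⟩)
    · refine Definable.exists_unit ((hXcomp _).inter (Definable.forall_unit
        (Definable.imp (hXcomp (Sum.inr ())) (Definable.imp
          (hrcomp (Sum.inl (Sum.inr ())) (Sum.inr ())) (Definable.iff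
          (definable_fiber_comp χ (Sum.inr ()) (Sum.inl ∘ Sum.inl ∘ Sum.inl))
          (definable_fiber_comp χ (Sum.inr ()) (Sum.inl ∘ Sum.inl ∘ Sum.inr)))))))
    · intro a b hab
      exact Filter.eventually_congr (hV _ hab)
    · exact hdp.exists_finset_sameGerm M lt hφ hmax χ fun (a : Fin n → A) i => (a i : M)
  · push Not at hmax
    obtain ⟨m, hmX, hm⟩ := hmax
    refine ⟨typeOfUltrafilter L A (pure m), (typeOfUltrafilter_contains φ).2 hmX,
      typeOfUltrafilter_pure_isDefinable ?_⟩
    have h1 : A.Definable L {v : Fin 1 → M | ∀ x, x ∈ X → ¬ r (v 0) x} :=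
      Definable.forall_unit (Definable.imp (hXcomp (Sum.inr ()))
        (hrcomp (Sum.inl 0) (Sum.inr ())).compl)
    refine (congrArg _ ?_).mp (hXdef.inter h1)
    ext v
    constructor
    · rintro ⟨h1, h2⟩
      rcases trichotomous_of r (v 0) m with h | h | h
      · exact absurd h (h2 m hmX)
      · exact h
      · exact absurd h (hm _ h1)
    · intro h
      have h : v 0 = m := h
      simp only [Set.mem_inter_iff, Set.mem_ofPred_eq, h]
      exact ⟨hmX, hm⟩

end Ordered

/-! ### Combinatorics of nested unpackable families and generic types of balls -/

section Balls

variable {M : Type*} {𝓘 : Set (Set M)}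

/-- The trace of `Y` on `B` is covered by finitely many members of the family `𝓘` that are
properly contained in `B`. -/
def IsSmallIn (𝓘 : Set (Set M)) (B Y : Set M) : Prop :=
  ∃ 𝒞 ⊆ 𝓘, 𝒞.Finite ∧ (∀ C ∈ 𝒞, C ⊂ B) ∧ B ∩ Y ⊆ ⋃₀ 𝒞

theorem IsSmallIn.mono {B Y Z : Set M} (h : IsSmallIn 𝓘 B Z) (hYZ : B ∩ Y ⊆ Z) :
    IsSmallIn 𝓘 B Y := by
  obtain ⟨𝒞, h𝒞, hfin, hC, hcov⟩ := h
  exact ⟨𝒞, h𝒞, hfin, hC, fun x hx => hcov ⟨hx.1, hYZ hx⟩⟩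

theorem IsSmallIn.union {B Y Z : Set M} (hY : IsSmallIn 𝓘 B Y) (hZ : IsSmallIn 𝓘 B Z) :
    IsSmallIn 𝓘 B (Y ∪ Z) := by
  obtain ⟨𝒞, h𝒞, hfin, hC, hcov⟩ := hY
  obtain ⟨𝒟, h𝒟, hfin', hD, hcov'⟩ := hZ
  refine ⟨𝒞 ∪ 𝒟, Set.union_subset h𝒞 h𝒟, hfin.union hfin', ?_, ?_⟩
  · rintro C (h | h)
    exacts [hC C h, hD C h]
  · rw [Set.sUnion_union, Set.inter_union_distrib_left]
    exact Set.union_subset_union hcov hcov'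

theorem isSmallIn_of_inter_eq_empty {B Y : Set M} (h : B ∩ Y = ∅) : IsSmallIn 𝓘 B Y :=
  ⟨∅, Set.empty_subset _, Set.finite_empty, by simp, by simp [h]⟩

theorem isSmallIn_of_ssubset {B C : Set M} (hC : C ∈ 𝓘) (h : C ⊂ B) : IsSmallIn 𝓘 B C :=
  ⟨{C}, by simpa, Set.finite_singleton _, by simpa, by simp⟩

/-- Any two members of the family are comparable or disjoint. -/
def IsNested (𝓘 : Set (Set M)) : Prop :=
  ∀ B ∈ 𝓘, ∀ C ∈ 𝓘, B ⊆ C ∨ C ⊆ B ∨ Disjoint B C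

/-- No nonempty member of the family is a finite union of proper subsets in the family. -/
def IsUnpackable (𝓘 : Set (Set M)) : Prop :=
  ∀ B ∈ 𝓘, B.Nonempty → ∀ 𝒞 ⊆ 𝓘, 𝒞.Finite → (∀ C ∈ 𝒞, C ⊂ B) → ⋃₀ 𝒞 ≠ B

/-- A single ball contains `B`, is properly contained in it, or misses it. The dichotomy passes to
complements by symmetry and to unions because small sets form an ideal. -/
theorem IsNested.isSmallIn_or (h : IsNested 𝓘) {B Y : Set M} (hB : B ∈ 𝓘)
    (hY : Y ∈ BooleanSubalgebra.closure 𝓘) : IsSmallIn 𝓘 B Y ∨ IsSmallIn 𝓘 B Yᶜ := by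
  induction hY using BooleanSubalgebra.closure_bot_sup_induction with
  | mem C hC =>
    rcases h B hB C hC with hBC | hCB | hdisj
    · refine Or.inr (isSmallIn_of_inter_eq_empty ?_)
      rw [← Set.sdiff_eq, Set.sdiff_eq_empty]
      exact hBC
    · by_cases hBC : B ⊆ C
      · refine Or.inr (isSmallIn_of_inter_eq_empty ?_)
        rw [← Set.sdiff_eq, Set.sdiff_eq_empty]
        exact hBC
      · exact Or.inl (isSmallIn_of_ssubset hC ⟨hCB, hBC⟩)
    · exact Or.inl (isSmallIn_of_inter_eq_empty hdisj.inter_eq)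
  | bot => exact Or.inl (isSmallIn_of_inter_eq_empty (Set.inter_empty B))
  | sup Y hY Z hZ ihY ihZ =>
    rcases ihY with ihY | ihY
    · rcases ihZ with ihZ | ihZ
      · exact Or.inl (ihY.union ihZ)
      · exact Or.inr (ihZ.mono fun x hx h => hx.2 (Or.inr h))
    · exact Or.inr (ihY.mono fun x hx h => hx.2 (Or.inl h))
  | compl Y hY ih =>
    rw [compl_compl]
    exact ih.symm

theorem IsUnpackable.not_isSmallIn (h : IsUnpackable 𝓘) {B Y : Set M} (hB : B ∈ 𝓘)
    (hne : B.Nonempty) (hBY : B ⊆ Y) : ¬ IsSmallIn 𝓘 B Y := by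
  rintro ⟨𝒞, h𝒞, hfin, hC, hcov⟩
  refine h B hB hne 𝒞 h𝒞 hfin hC (Set.Subset.antisymm ?_ ?_)
  · exact Set.sUnion_subset fun C h => (hC C h).1
  · exact fun x hx => hcov ⟨hx, hBY hx⟩

/-- The filter generated by `B` and the complements of the smaller members of the family. -/
def genericFilter (𝓘 : Set (Set M)) (B : Set M) : Filter M where
  sets := {Y | IsSmallIn 𝓘 B Yᶜ}
  univ_sets := isSmallIn_of_inter_eq_empty (by simp)
  sets_of_superset := fun h hYZ => h.mono fun _ hx h => hx.2 (hYZ h)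
  inter_sets := fun hY hZ => (hY.union hZ).mono fun x hx => by
    rw [← Set.compl_inter]
    exact hx.2

/-- The generic type of a ball. -/
theorem exists_generic (hnest : IsNested 𝓘) (hunp : IsUnpackable 𝓘) {B : Set M} (hB : B ∈ 𝓘)
    (hne : B.Nonempty) : ∃ V : Ultrafilter M,
      (∀ Y ∈ BooleanSubalgebra.closure 𝓘, Y ∈ V ↔ IsSmallIn 𝓘 B Yᶜ) ∧
      ∀ C ∈ 𝓘, C ∈ V ↔ B ⊆ C := by
  have : (genericFilter 𝓘 B).NeBot := by
    rw [Filter.neBot_iff, Ne, ← Filter.empty_mem_iff_bot]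
    exact hunp.not_isSmallIn hB hne (by simp)
  have hV : ∀ Y, IsSmallIn 𝓘 B Yᶜ → Y ∈ Ultrafilter.of (genericFilter 𝓘 B) :=
    fun Y hY => Ultrafilter.of_le (genericFilter 𝓘 B) hY
  have hY : ∀ Y ∈ BooleanSubalgebra.closure 𝓘,
      Y ∈ Ultrafilter.of (genericFilter 𝓘 B) ↔ IsSmallIn 𝓘 B Yᶜ := by
    refine fun Y hY => ⟨fun h => ?_, hV Y⟩
    rcases hnest.isSmallIn_or hB hY with h1 | h1
    · rw [← compl_compl Y] at h1
      exact absurd h (Ultrafilter.compl_mem_iff_notMem.1 (hV _ h1))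
    · exact h1
  refine ⟨_, hY, fun C hC => ?_⟩
  rw [hY C (BooleanSubalgebra.subset_closure hC)]
  refine ⟨fun h => ?_, fun h => isSmallIn_of_inter_eq_empty ?_⟩
  · by_contra hBC
    have h2 : IsSmallIn 𝓘 B C := by
      rcases hnest B hB C hC with h3 | h3 | h3
      · exact absurd h3 hBC
      · exact isSmallIn_of_ssubset hC ⟨h3, hBC⟩
      · exact isSmallIn_of_inter_eq_empty h3.inter_eq
    exact hunp.not_isSmallIn hB hne (fun x _ => em (x ∈ C)) (h2.union h)
  · rw [← Set.sdiff_eq, Set.sdiff_eq_empty]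
    exact h

theorem ultrafilter_mem_iff_of_closure {V W : Ultrafilter M} {𝒞 : Set (Set M)}
    (h : ∀ C ∈ 𝒞, C ∈ V ↔ C ∈ W) {Y : Set M} (hY : Y ∈ BooleanSubalgebra.closure 𝒞) :
    Y ∈ V ↔ Y ∈ W := by
  induction hY using BooleanSubalgebra.closure_bot_sup_induction with
  | mem C hC => exact h C hC
  | bot => exact iff_of_false V.empty_notMem W.empty_notMem
  | sup Y hY Z hZ ihY ihZ =>
    exact Ultrafilter.union_mem_iff.trans ((or_congr ihY ihZ).trans Ultrafilter.union_mem_iff.symm)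
  | compl Y hY ih =>
    rw [Ultrafilter.compl_mem_iff_notMem, Ultrafilter.compl_mem_iff_notMem, ih]

theorem exists_finite_mem_closure {Y : Set M} (hY : Y ∈ BooleanSubalgebra.closure 𝓘) :
    ∃ 𝒞 ⊆ 𝓘, 𝒞.Finite ∧ Y ∈ BooleanSubalgebra.closure 𝒞 := by
  induction hY using BooleanSubalgebra.closure_bot_sup_induction with
  | mem C hC =>
    exact ⟨{C}, by simpa, Set.finite_singleton _, BooleanSubalgebra.subset_closure rfl⟩
  | bot => exact ⟨∅, Set.empty_subset _, Set.finite_empty, BooleanSubalgebra.bot_mem⟩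
  | sup Y hY Z hZ ihY ihZ =>
    obtain ⟨𝒞, h𝒞, hfin, hC⟩ := ihY
    obtain ⟨𝒟, h𝒟, hfin', hD⟩ := ihZ
    exact ⟨𝒞 ∪ 𝒟, Set.union_subset h𝒞 h𝒟, hfin.union hfin', BooleanSubalgebra.sup_mem
      (BooleanSubalgebra.closure_mono Set.subset_union_left hC)
      (BooleanSubalgebra.closure_mono Set.subset_union_right hD)⟩
  | compl Y hY ih =>
    obtain ⟨𝒞, h𝒞, hfin, hC⟩ := ih
    exact ⟨𝒞, h𝒞, hfin, BooleanSubalgebra.compl_mem hC⟩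

/-- If a Boolean combination `X` of a finite cover by balls is almost everywhere true, then it
contains the generic type of one of these balls. -/
theorem exists_ball_of_mem_ultrafilter (hnest : IsNested 𝓘) (hunp : IsUnpackable 𝓘)
    {𝒞 : Set (Set M)} (h𝒞 : 𝒞 ⊆ 𝓘) (hfin : 𝒞.Finite) (hcov : ⋃₀ 𝒞 = Set.univ) {X : Set M}
    (hX : X ∈ BooleanSubalgebra.closure 𝒞) {W : Ultrafilter M} (hXW : X ∈ W) :
    ∃ C ∈ 𝒞, C ∈ W ∧ C.Nonempty ∧ IsSmallIn 𝓘 C Xᶜ := by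
  have hne : {C ∈ 𝒞 | C ∈ W}.Nonempty := by
    obtain ⟨C, hC, hCW⟩ := (Ultrafilter.finite_sUnion_mem_iff (f := W) hfin).1
      (by rw [hcov]; exact Filter.univ_mem)
    exact ⟨C, hC, hCW⟩
  -- For `C` minimal among the members of `𝒞` in `W`, the generic type of `C` and `W` contain the
  -- same members of `𝒞`, hence agree on `X`.
  obtain ⟨C, ⟨hC, hCW⟩, hmin⟩ := (hfin.subset (Set.sep_subset 𝒞 _)).exists_minimal hne
  have hCne : C.Nonempty := W.nonempty_of_mem hCW
  obtain ⟨V, hV, hVC⟩ := exists_generic hnest hunp (h𝒞 hC) hCne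
  refine ⟨C, hC, hCW, hCne, (hV X (BooleanSubalgebra.closure_mono h𝒞 hX)).1 ?_⟩
  refine (ultrafilter_mem_iff_of_closure (fun D hD => ?_) hX).2 hXW
  rw [hVC D (h𝒞 hD)]
  refine ⟨fun h => Filter.mem_of_superset hCW h, fun hDW => ?_⟩
  rcases hnest C (h𝒞 hC) D (h𝒞 hD) with h | h | h
  · exact h
  · exact hmin ⟨hD, hDW⟩ h
  · have := Filter.inter_mem hCW hDW
    rw [h.inter_eq] at this
    exact absurd this W.empty_notMem

/-- A ball of the family `𝓘₀` whose generic type contains `X`. -/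
def IsGenericBall (𝓘 𝓘₀ : Set (Set M)) (X B : Set M) : Prop :=
  B ∈ 𝓘₀ ∧ B.Nonempty ∧ IsSmallIn 𝓘 B Xᶜ

/-- Applying `exists_ball_of_mem_ultrafilter` to the generic type of a ball `B` puts `B` inside a
ball of `𝒞` that is again generic for `X`. So maximal ones lie in the finite set `𝒞`. A point of
`X`, as a principal ultrafilter, shows that there are any. -/
theorem maximal_isGenericBall (hnest : IsNested 𝓘) (hunp : IsUnpackable 𝓘)
    {𝒞 𝓘₀ : Set (Set M)} (h𝒞 : 𝒞 ⊆ 𝓘₀) (h𝓘₀ : 𝓘₀ ⊆ 𝓘) (hfin : 𝒞.Finite)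
    (hcov : ⋃₀ 𝒞 = Set.univ) {X : Set M} (hX : X ∈ BooleanSubalgebra.closure 𝒞)
    (hne : X.Nonempty) :
    {B | Maximal (IsGenericBall 𝓘 𝓘₀ X) B}.Finite ∧ ∃ B, Maximal (IsGenericBall 𝓘 𝓘₀ X) B := by
  have habove : ∀ B, IsGenericBall 𝓘 𝓘₀ X B → ∃ C ∈ 𝒞, IsGenericBall 𝓘 𝓘₀ X C ∧ B ⊆ C := by
    rintro B ⟨hB, hBne, hBX⟩
    obtain ⟨V, hV, hVC⟩ := exists_generic hnest hunp (h𝓘₀ hB) hBne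
    obtain ⟨C, hC, hCV, hCne, hCX⟩ := exists_ball_of_mem_ultrafilter hnest hunp
      (h𝒞.trans h𝓘₀) hfin hcov hX
      ((hV X (BooleanSubalgebra.closure_mono (h𝒞.trans h𝓘₀) hX)).2 hBX)
    exact ⟨C, hC, ⟨h𝒞 hC, hCne, hCX⟩, (hVC C (h𝓘₀ (h𝒞 hC))).1 hCV⟩
  refine ⟨hfin.subset fun B hB => ?_, ?_⟩
  · obtain ⟨C, hC, hCg, hBC⟩ := habove B hB.1
    rwa [Set.Subset.antisymm hBC (hB.2 hCg hBC)]
  · obtain ⟨x, hx⟩ := hne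
    obtain ⟨C, hC, -, hCne, hCX⟩ := exists_ball_of_mem_ultrafilter hnest hunp
      (h𝒞.trans h𝓘₀) hfin hcov hX (W := pure x) hx
    obtain ⟨B, ⟨hB, hBg⟩, hmax⟩ := (hfin.subset
      (Set.sep_subset 𝒞 (IsGenericBall 𝓘 𝓘₀ X))).exists_maximal ⟨C, hC, h𝒞 hC, hCne, hCX⟩
    refine ⟨B, hBg, fun B' hB' hBB' => ?_⟩
    obtain ⟨C', hC', hCg', hBC'⟩ := habove B' hB'
    exact hBC'.trans (hmax ⟨hC', hCg'⟩ (hBB'.trans hBC'))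

end Balls

/-! ### First-order expression of finite covers by smaller balls -/

section UniformCover

variable {L : Language.{u, v}}

/-- The formula stating that the point `i` belongs to the fiber of `χ` at the tuple `g`. -/
def memFormula {α : Type*} {n : ℕ} (χ : L.Formula (Fin (n + 1))) (i : α) (g : Fin n → α) :
    L.Formula α :=
  χ.relabel (Fin.cons i g : Fin (n + 1) → α)

theorem realize_memFormula {M : Type*} [L.Structure M] {α : Type*} {n : ℕ}
    (χ : L.Formula (Fin (n + 1))) (i : α) (g : Fin n → α) (v : α → M) :
    (memFormula χ i g).Realize v ↔ v i ∈ fiber χ (v ∘ g) := by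
  rw [memFormula, Formula.realize_relabel]
  refine iff_of_eq (congrArg χ.Realize ?_)
  funext t
  refine Fin.cases ?_ (fun t => ?_) t <;> simp

/-- The formula stating that a fiber of `χ` is contained in a fiber of `χ'`. -/
noncomputable def subsetFormula {α : Type*} {n m : ℕ} (χ : L.Formula (Fin (n + 1)))
    (g : Fin n → α) (χ' : L.Formula (Fin (m + 1))) (g' : Fin m → α) : L.Formula α :=
  Formula.iAlls Unit (memFormula χ (Sum.inr ()) (Sum.inl ∘ g) ⟹
    memFormula χ' (Sum.inr ()) (Sum.inl ∘ g'))

theorem realize_subsetFormula {M : Type*} [L.Structure M] {α : Type*} {n m : ℕ}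
    (χ : L.Formula (Fin (n + 1))) (g : Fin n → α) (χ' : L.Formula (Fin (m + 1)))
    (g' : Fin m → α) (v : α → M) :
    (subsetFormula χ g χ' g').Realize v ↔ fiber χ (v ∘ g) ⊆ fiber χ' (v ∘ g') := by
  simp only [subsetFormula, Formula.realize_iAlls, Formula.realize_imp, realize_memFormula]
  exact ⟨fun h x => h fun _ => x, fun h x => @h (x ())⟩

variable {Ψ : Set (Σ n : ℕ, L.Formula (Fin (n + 1)))}

/-- The trace of `Y` on `B` is covered by instances that are properly contained in `B`, one
instance for each index in `F`. -/
def IsCoveredBy {M : Type*} [L.Structure M] (F : Finset (Ψ × ℕ)) (B Y : Set M) : Prop :=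
  ∃ c : ∀ e : Ψ × ℕ, Fin e.1.1.1 → M,
    ∀ x ∈ B, x ∈ Y → ∃ e ∈ F, x ∈ fiber e.1.1.2 (c e) ∧ fiber e.1.1.2 (c e) ⊂ B

/-- Proper containment is demanded only of the instance covering the given point, so the parameters
at additional indices are harmless. -/
theorem IsCoveredBy.mono {M : Type*} [L.Structure M] {F G : Finset (Ψ × ℕ)} {B Y : Set M}
    (h : IsCoveredBy F B Y) (hFG : F ⊆ G) : IsCoveredBy G B Y := by
  obtain ⟨c, hc⟩ := h
  refine ⟨c, fun x hB hY => ?_⟩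
  obtain ⟨e, he, h⟩ := hc x hB hY
  exact ⟨e, hFG he, h⟩

theorem IsCoveredBy.isSmallIn {M : Type*} [L.Structure M] {F : Finset (Ψ × ℕ)} {B Y : Set M}
    (h : IsCoveredBy F B Y) : IsSmallIn (instances M Ψ) B Y := by
  obtain ⟨c, hc⟩ := h
  refine ⟨{C ∈ (fun e : Ψ × ℕ => fiber e.1.1.2 (c e)) '' F | C ⊂ B}, ?_, ?_, ?_, ?_⟩
  · rintro _ ⟨⟨e, -, rfl⟩, -⟩
    exact ⟨e.1.1, e.1.2, c e, rfl⟩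
  · exact (F.finite_toSet.image _).subset (Set.sep_subset _ _)
  · exact fun C hC => hC.2
  · rintro x ⟨hB, hY⟩
    obtain ⟨e, he, hx, hlt⟩ := hc x hB hY
    exact ⟨_, ⟨⟨e, he, rfl⟩, hlt⟩, hx⟩

theorem IsSmallIn.exists_isCoveredBy {M : Type*} [L.Structure M] [Nonempty M] {B Y : Set M}
    (h : IsSmallIn (instances M Ψ) B Y) : ∃ F : Finset (Ψ × ℕ), IsCoveredBy F B Y := by
  classical
  obtain ⟨𝒞, h𝒞, hfin, hlt, hcov⟩ := h
  have : Finite 𝒞 := hfin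
  obtain ⟨enc, henc⟩ := exists_injective_nat 𝒞
  choose ψ hψ b hb using fun C : 𝒞 => h𝒞 C.2
  -- The second component separates balls that are instances of the same formula.
  let key : 𝒞 → Ψ × ℕ := fun C => (⟨ψ C, hψ C⟩, enc C)
  have hkey : Function.Injective key := fun C D h => henc (congrArg Prod.snd h)
  have hex : ∀ e : Ψ × ℕ, ∃ c : Fin e.1.1.1 → M, ∀ C : 𝒞, key C = e →
      (C : Set M) = fiber e.1.1.2 c := by
    intro e
    by_cases h : ∃ C, key C = e
    · obtain ⟨C, rfl⟩ := h
      refine ⟨b C, fun D hD => ?_⟩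
      obtain rfl := hkey hD
      exact hb D
    · exact ⟨fun _ => Classical.arbitrary M, fun C hC => absurd ⟨C, hC⟩ h⟩
  choose c hc using hex
  have := Fintype.ofFinite 𝒞
  refine ⟨Finset.univ.image key, c, fun x hB hY => ?_⟩
  obtain ⟨C, hC, hx⟩ := hcov ⟨hB, hY⟩
  have h1 := hc (key ⟨C, hC⟩) ⟨C, hC⟩ rfl
  refine ⟨key ⟨C, hC⟩, Finset.mem_image_of_mem _ (Finset.mem_univ _), ?_, ?_⟩
  · rw [← h1]
    exact hx
  · rw [← h1]
    exact hlt C hC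

/-- The formula does not depend on the structure, so it can be transferred between a model and its
ultrapower. -/
theorem exists_formula_isCoveredBy (F : Finset (Ψ × ℕ)) {n₀ n : ℕ}
    (ψ : L.Formula (Fin (n₀ + 1))) (θ : L.Formula (Fin (n + 1))) :
    ∃ σ : L.Formula (Fin n₀ ⊕ Fin n), ∀ (M : Type w) [L.Structure M] [Nonempty M]
      (v : Fin n₀ ⊕ Fin n → M), σ.Realize v ↔
        IsCoveredBy F (fiber ψ (v ∘ Sum.inl)) (fiber θ (v ∘ Sum.inr)) := by
  classical
  let γ := Σ e : F, Fin e.1.1.1.1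
  let body : L.Formula (((Fin n₀ ⊕ Fin n) ⊕ γ) ⊕ Unit) :=
    memFormula ψ (Sum.inr ()) (Sum.inl ∘ Sum.inl ∘ Sum.inl) ⟹
    memFormula θ (Sum.inr ()) (Sum.inl ∘ Sum.inl ∘ Sum.inr) ⟹
    Formula.iSup fun e : F =>
      memFormula e.1.1.1.2 (Sum.inr ()) (fun i => Sum.inl (Sum.inr ⟨e, i⟩)) ⊓
      (subsetFormula e.1.1.1.2 (fun i => Sum.inl (Sum.inr ⟨e, i⟩)) ψ
          (Sum.inl ∘ Sum.inl ∘ Sum.inl) ⊓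
        ∼(subsetFormula ψ (Sum.inl ∘ Sum.inl ∘ Sum.inl) e.1.1.1.2
          (fun i => Sum.inl (Sum.inr ⟨e, i⟩))))
  refine ⟨Formula.iExs γ (Formula.iAlls Unit body), fun M _ _ v => ?_⟩
  have hbody : ∀ w : γ → M, (Formula.iAlls Unit body).Realize (Sum.elim v w) ↔
      ∀ x ∈ fiber ψ (v ∘ Sum.inl), x ∈ fiber θ (v ∘ Sum.inr) →
        ∃ e : F, x ∈ fiber e.1.1.1.2 (fun i => w ⟨e, i⟩) ∧
          fiber e.1.1.1.2 (fun i => w ⟨e, i⟩) ⊂ fiber ψ (v ∘ Sum.inl) := by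
    intro w
    simp only [body, Formula.realize_iAlls, Formula.realize_imp, Formula.realize_iSup,
      Formula.realize_inf, Formula.realize_not, realize_memFormula, realize_subsetFormula]
    exact ⟨fun h x => h fun _ => x, fun h x => h (x ())⟩
  rw [Formula.realize_iExs]
  simp_rw [hbody]
  constructor
  · rintro ⟨w, hw⟩
    refine ⟨fun e i => if h : e ∈ F then w ⟨⟨e, h⟩, i⟩ else Classical.arbitrary M,
      fun x hB hY => ?_⟩
    obtain ⟨e, he, hlt⟩ := hw x hB hY
    refine ⟨e, e.2, ?_⟩
    simp only [dif_pos e.2]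
    exact ⟨he, hlt⟩
  · rintro ⟨c, hc⟩
    refine ⟨fun s => c s.1 s.2, fun x hB hY => ?_⟩
    obtain ⟨e, he, h⟩ := hc x hB hY
    exact ⟨⟨e, he⟩, h⟩

end UniformCover

/-! ### Uniform definability of generic types -/

section Generic

variable {L : Language.{u, v}} {T : L.Theory} {Ψ : Set (Σ n : ℕ, L.Formula (Fin (n + 1)))}

theorem fiber_mem_closure (hgen : T.IsGeneratingFamily Ψ)
    (M : Theory.ModelType.{u, v, max u v} T) {n : ℕ} (θ : L.Formula (Fin (n + 1)))
    (a : Fin n → M) : fiber θ a ∈ BooleanSubalgebra.closure (instances M Ψ) := by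
  refine hgen M _ ?_
  exact Definable.fix_params (A := Set.univ)
    (P := fun (y : Fin n → M) (v : Fin 1 → M) => v 0 ∈ fiber θ y)
    (definable_fiber_comp θ (Sum.inr 0) Sum.inl) fun i => ⟨a i, Set.mem_univ _⟩

/-- Compactness: counterexamples for every `F` combine, in an ultrapower along an ultrafilter finer
than `atTop`, to a ball and a definable set with neither the set nor its complement small in the
ball, against `IsNested.isSmallIn_or`. -/
theorem exists_uniform_isCoveredBy (hdir : T.IsDirectedFamily Ψ) (hgen : T.IsGeneratingFamily Ψ)
    (M : Theory.ModelType.{u, v, max u v} T) {n₀ n : ℕ} {ψ : L.Formula (Fin (n₀ + 1))}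
    (hψ : ⟨n₀, ψ⟩ ∈ Ψ) (θ : L.Formula (Fin (n + 1))) :
    ∃ F : Finset (Ψ × ℕ), ∀ (b : Fin n₀ → M) (a : Fin n → M),
      IsCoveredBy F (fiber ψ b) (fiber θ a) ∨ IsCoveredBy F (fiber ψ b) (fiber θ a)ᶜ := by
  classical
  by_contra! hcon
  choose b a hθ hθ' using hcon
  let V : Ultrafilter (Finset (Ψ × ℕ)) := Ultrafilter.of Filter.atTop
  have : Nonempty (Ultrapower V M) := ultrapower_nonempty V
  have : Ultrapower V M ⊨ T := ultrapower_model V T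
  let N : Theory.ModelType.{u, v, max u v} T := Theory.ModelType.of T (Ultrapower V M)
  let b' : Fin n₀ → Ultrapower V M := fun i => ultrapowerMk V fun F => b F i
  let a' : Fin n → Ultrapower V M := fun i => ultrapowerMk V fun F => a F i
  have transfer : ∀ θ : L.Formula (Fin (n + 1)),
      (∀ F, ¬ IsCoveredBy F (fiber ψ (b F)) (fiber θ (a F))) →
        ¬ IsSmallIn (instances (Ultrapower V M) Ψ) (fiber ψ b') (fiber θ a') := by
    intro θ hθ hsmall
    obtain ⟨F, hF⟩ := hsmall.exists_isCoveredBy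
    obtain ⟨σ, hσ⟩ := exists_formula_isCoveredBy.{u, v, max u v} F ψ θ
    have h1 : σ.Realize (fun i => ultrapowerMk V
        ((Sum.elim (fun i F => b F i) fun i F => a F i : Fin n₀ ⊕ Fin n → _) i)) :=
      (hσ (Ultrapower V M) _).2 hF
    rw [realize_ultrapowerMk] at h1
    have h2 : ∀ᶠ G in (V : Filter (Finset (Ψ × ℕ))), F ⊆ G :=
      Ultrafilter.of_le Filter.atTop (Filter.eventually_ge_atTop F)
    obtain ⟨G, hG, hFG⟩ := (h1.and h2).exists
    exact hθ G (((hσ M _).1 hG).mono hFG)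
  rcases IsNested.isSmallIn_or (hdir N) (B := fiber ψ b') ⟨_, hψ, b', rfl⟩
    (fiber_mem_closure hgen N θ a') with h | h
  · exact transfer θ hθ h
  · exact transfer θ.not hθ' h

/-- That the generic type of a ball contains a set is definable in families. -/
theorem exists_formula_isSmallIn (hdir : T.IsDirectedFamily Ψ) (hgen : T.IsGeneratingFamily Ψ)
    (M : Theory.ModelType.{u, v, max u v} T) (hunp : IsUnpackable (instances M Ψ)) {n₀ n : ℕ}
    {ψ : L.Formula (Fin (n₀ + 1))} (hψ : ⟨n₀, ψ⟩ ∈ Ψ) (θ : L.Formula (Fin (n + 1))) :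
    ∃ σ : L.Formula (Fin n₀ ⊕ Fin n), ∀ v : Fin n₀ ⊕ Fin n → M, σ.Realize v ↔
      IsSmallIn (instances M Ψ) (fiber ψ (v ∘ Sum.inl)) (fiber θ (v ∘ Sum.inr))ᶜ := by
  obtain ⟨F, hF⟩ := exists_uniform_isCoveredBy hdir hgen M hψ θ
  obtain ⟨σ, hσ⟩ := exists_formula_isCoveredBy.{u, v, max u v} F ψ θ.not
  refine ⟨σ, fun v => (hσ M v).trans ⟨IsCoveredBy.isSmallIn, fun h => ?_⟩⟩
  -- If the fiber itself is the part covered along `F`, the whole ball is small in itself, hence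
  -- empty by unpackability, and the cover is vacuous.
  rcases hF (v ∘ Sum.inl) (v ∘ Sum.inr) with h1 | h1
  · have hempty : ¬ (fiber ψ (v ∘ Sum.inl)).Nonempty := fun hne =>
      hunp.not_isSmallIn ⟨_, hψ, v ∘ Sum.inl, rfl⟩ hne (fun x _ => em _) (h1.isSmallIn.union h)
    exact ⟨fun _ _ => Classical.arbitrary M, fun x hx => absurd ⟨x, hx⟩ hempty⟩
  · exact h1

end Generic

/-! ### Quantification over indices and tuples -/

section Definability

variable {L : Language.{u, v}} {M : Type w} [L.Structure M]

theorem Definable.forall_index {A : Set M} {α ι : Type*} [Finite ι] {P : ι → (α → M) → Prop}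
    (h : ∀ i, A.Definable L {v | P i v}) : A.Definable L {v | ∀ i, P i v} := by
  refine (congrArg _ ?_).mp (Set.definable_iInter_of_finite h)
  ext v
  simp

theorem Definable.forall_tuple {A : Set M} {α β : Type*} [Finite β]
    {P : (α → M) → (β → M) → Prop}
    (h : A.Definable L {v : α ⊕ β → M | P (v ∘ Sum.inl) (v ∘ Sum.inr)}) :
    A.Definable L {v : α → M | ∀ w, P v w} :=
  h.forall_of_finite

theorem definable_fiber_subset {A : Set M} {α : Type*} {n m : ℕ} (χ : L.Formula (Fin (n + 1)))
    (g : Fin n → α) (χ' : L.Formula (Fin (m + 1))) (g' : Fin m → α) :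
    A.Definable L {v : α → M | fiber χ (v ∘ g) ⊆ fiber χ' (v ∘ g')} := by
  refine (congrArg _ ?_).mp (definable_realize_comp A (subsetFormula χ g χ' g') id)
  ext v
  exact realize_subsetFormula χ g χ' g' v

end Definability

theorem exists_finset_representatives {α β : Type*} [Finite β] (f : α → β) :
    ∃ F : Finset α, ∀ a, ∃ b ∈ F, f b = f a := by
  classical
  choose g hg using fun y : Set.range f => y.2
  have := Fintype.ofFinite (Set.range f)
  exact ⟨Finset.univ.image g, fun a => ⟨g ⟨f a, a, rfl⟩,
    Finset.mem_image_of_mem _ (Finset.mem_univ _), hg _⟩⟩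

/-! ### Unpackable VC-minimal theories -/

section VCMinimal

variable {L : Language.{u, v}} {T : L.Theory} {Ψ : Set (Σ n : ℕ, L.Formula (Fin (n + 1)))}

theorem exists_finset_instances {M : Type w} [L.Structure M] {𝒞 : Set (Set M)}
    (h𝒞 : 𝒞 ⊆ instances M Ψ) (hfin : 𝒞.Finite) :
    ∃ Ψ₀ : Finset (Σ n : ℕ, L.Formula (Fin (n + 1))), ↑Ψ₀ ⊆ Ψ ∧
      𝒞 ⊆ instances (L := L) M ↑Ψ₀ := by
  classical
  choose ψ hψ b hb using fun C : 𝒞 => h𝒞 C.2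
  have : Finite 𝒞 := hfin
  have := Fintype.ofFinite 𝒞
  refine ⟨Finset.univ.image ψ, ?_, fun C hC => ⟨ψ ⟨C, hC⟩, ?_, b ⟨C, hC⟩, hb ⟨C, hC⟩⟩⟩
  · rw [Finset.coe_image]
    rintro _ ⟨C, -, rfl⟩
    exact hψ C
  · exact Finset.mem_image_of_mem _ (Finset.mem_univ _)

theorem instances_mono {M : Type w} [L.Structure M]
    {Ψ₀ Ψ : Set (Σ n : ℕ, L.Formula (Fin (n + 1)))} (h : Ψ₀ ⊆ Ψ) :
    instances M Ψ₀ ⊆ instances M Ψ :=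
  fun _ ⟨ψ, hψ, b, hb⟩ => ⟨ψ, h hψ, b, hb⟩

/-- Maximality quantifies over the instances of `Ψ₀`; since `Ψ₀` is finite, this is a finite
conjunction of first-order conditions. -/
theorem definable_maximal_isGenericBall (hdir : T.IsDirectedFamily Ψ)
    (hgen : T.IsGeneratingFamily Ψ) (M : Theory.ModelType.{u, v, max u v} T)
    (hunp : IsUnpackable (instances M Ψ)) {A : Set M}
    {Ψ₀ : Finset (Σ n : ℕ, L.Formula (Fin (n + 1)))} (hΨ₀ : ↑Ψ₀ ⊆ Ψ) {k : ℕ}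
    (θ : L.Formula (Fin (k + 1))) (a : Fin k → A) (ψ : Ψ₀) :
    A.Definable L {d : Fin ψ.1.1 → M | Maximal
      (IsGenericBall (instances M Ψ) (instances (L := L) M ↑Ψ₀)
      (fiber θ fun i => (a i : M))) (fiber ψ.1.2 d)} := by
  set X := fiber θ fun i => (a i : M) with hX
  have hball : ∀ ψ : Ψ₀, A.Definable L {d : Fin ψ.1.1 → M |
      IsGenericBall (instances M Ψ) (instances (L := L) M ↑Ψ₀) X (fiber ψ.1.2 d)} := by
    intro ψ
    obtain ⟨σ, hσ⟩ := exists_formula_isSmallIn hdir hgen M hunp (hΨ₀ ψ.2) θ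
    have h1 : A.Definable L {d : Fin ψ.1.1 → M | ∃ x, x ∈ fiber ψ.1.2 d} :=
      Definable.exists_unit (definable_fiber_comp ψ.1.2 (Sum.inr ()) Sum.inl)
    have h2 : A.Definable L {d : Fin ψ.1.1 → M |
        IsSmallIn (instances M Ψ) (fiber ψ.1.2 d) Xᶜ} := by
      refine Definable.fix_params (P := fun (y : Fin k → M) (d : Fin ψ.1.1 → M) =>
        IsSmallIn (instances M Ψ) (fiber ψ.1.2 d) (fiber θ y)ᶜ) ?_ a
      refine (congrArg _ ?_).mp (definable_realize_comp A σ Sum.swap)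
      ext v
      exact hσ _
    refine (congrArg _ ?_).mp (h1.inter h2)
    ext d
    exact ⟨fun h => ⟨⟨ψ.1, ψ.2, d, rfl⟩, h⟩, fun h => h.2⟩
  have hmax : A.Definable L {d : Fin ψ.1.1 → M | ∀ (ψ' : Ψ₀) (d' : Fin ψ'.1.1 → M),
      IsGenericBall (instances M Ψ) (instances (L := L) M ↑Ψ₀) X (fiber ψ'.1.2 d') →
        fiber ψ.1.2 d ⊆ fiber ψ'.1.2 d' → fiber ψ'.1.2 d' ⊆ fiber ψ.1.2 d} :=
    Definable.forall_index fun ψ' => Definable.forall_tuple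
      (Definable.imp ((hball ψ').preimage_comp Sum.inr) (Definable.imp
        (definable_fiber_subset _ Sum.inl _ Sum.inr) (definable_fiber_subset _ Sum.inr _ Sum.inl)))
  refine (congrArg _ ?_).mp ((hball ψ).inter hmax)
  ext d
  refine and_congr_right fun _ => ⟨fun h B hB hle => ?_, fun h ψ' d' hB hle => h hB hle⟩
  obtain ⟨ψ', hψ', d', rfl⟩ := hB.1
  exact h ⟨ψ', hψ'⟩ d' hB hle

/-- The chosen maximal ball `B` need not be definable over `A`, but the finite set of all maximal
balls is; hence the relation compares two fibers at all of them. Unpackability is asked in `M`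
alone, so that the lemma still applies when `M` itself is added as a ball. -/
theorem exists_definable_type_of_cover (hdir : T.IsDirectedFamily Ψ)
    (hgen : T.IsGeneratingFamily Ψ) (M : Theory.ModelType.{u, v, max u v} T)
    (hunp : IsUnpackable (instances M Ψ)) {𝒟 : Set (Set M)} (h𝒟 : 𝒟 ⊆ instances M Ψ)
    (h𝒟fin : 𝒟.Finite) (h𝒟cov : ⋃₀ 𝒟 = Set.univ) (A : Set M) (φ : L[[A]].Formula (Fin 1))
    (hφ : ∃ x : M, φ.Realize fun _ => x) :
    ∃ p : TypeOver L A, p.Contains φ ∧ p.IsDefinable := by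
  obtain ⟨k, θ, a, hθ⟩ := exists_formula_realize_iff φ
  set X := fiber θ fun i => (a i : M) with hX
  have hXne : X.Nonempty := hφ.imp fun x hx => (hθ x).1 hx
  have hnest : IsNested (instances M Ψ) := hdir M
  have hXcl : X ∈ BooleanSubalgebra.closure (instances M Ψ) := fiber_mem_closure hgen M θ _
  obtain ⟨𝒞₀, h𝒞₀, h𝒞₀fin, hX𝒞₀⟩ := exists_finite_mem_closure hXcl
  obtain ⟨Ψ₀, hΨ₀, hinst⟩ := exists_finset_instances (Set.union_subset h𝒞₀ h𝒟)
    (h𝒞₀fin.union h𝒟fin)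
  obtain ⟨hmaxfin, B, hB⟩ := maximal_isGenericBall hnest hunp hinst (instances_mono hΨ₀)
    (h𝒞₀fin.union h𝒟fin)
    (Set.eq_univ_of_univ_subset (h𝒟cov ▸ Set.sUnion_mono Set.subset_union_right))
    (BooleanSubalgebra.closure_mono Set.subset_union_left hX𝒞₀) hXne
  obtain ⟨V, hV, -⟩ := exists_generic hnest hunp (instances_mono hΨ₀ hB.1.1) hB.1.2.1
  refine ⟨typeOfUltrafilter L A V, ?_, typeOfUltrafilter_isDefinable_of_finite fun n χ =>
    ⟨fun y z => ∀ C, Maximal (IsGenericBall (instances M Ψ) (instances (L := L) M ↑Ψ₀) X) C →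
      (IsSmallIn (instances M Ψ) C (fiber χ y)ᶜ ↔ IsSmallIn (instances M Ψ) C (fiber χ z)ᶜ),
      ?_, ?_, ?_⟩⟩
  · rw [typeOfUltrafilter_contains]
    have hXV : X ∈ V := (hV X hXcl).2 hB.1.2.2
    exact Filter.mem_of_superset hXV fun x hx => (hθ x).2 hx
  · have hdef : A.Definable L {v : Fin n ⊕ Fin n → M | ∀ (ψ : Ψ₀) (d : Fin ψ.1.1 → M),
        Maximal (IsGenericBall (instances M Ψ) (instances (L := L) M ↑Ψ₀) X) (fiber ψ.1.2 d) →
        (IsSmallIn (instances M Ψ) (fiber ψ.1.2 d) (fiber χ (v ∘ Sum.inl))ᶜ ↔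
          IsSmallIn (instances M Ψ) (fiber ψ.1.2 d) (fiber χ (v ∘ Sum.inr))ᶜ)} := by
      refine Definable.forall_index fun ψ => Definable.forall_tuple (Definable.imp
        ((definable_maximal_isGenericBall hdir hgen M hunp hΨ₀ θ a ψ).preimage_comp Sum.inr) ?_)
      obtain ⟨σ, hσ⟩ := exists_formula_isSmallIn hdir hgen M hunp (hΨ₀ ψ.2) χ
      have hcomp : ∀ g : Fin n → Fin n ⊕ Fin n,
          A.Definable L {v : (Fin n ⊕ Fin n) ⊕ Fin ψ.1.1 → M | IsSmallIn (instances M Ψ)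
            (fiber ψ.1.2 (v ∘ Sum.inr)) (fiber χ ((v ∘ Sum.inl) ∘ g))ᶜ} := by
        intro g
        refine (congrArg _ ?_).mp
          (definable_realize_comp A σ (Sum.elim Sum.inr (Sum.inl ∘ g)))
        ext v
        exact hσ _
      exact Definable.iff (hcomp Sum.inl) (hcomp Sum.inr)
    refine (congrArg _ ?_).mp hdef
    ext v
    refine ⟨fun h C hC => ?_, fun h ψ d hd => h _ hd⟩
    obtain ⟨ψ, hψ, d, rfl⟩ := hC.1.1
    exact h ⟨ψ, hψ⟩ d hC
  · intro y z hyz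
    rw [hV _ (fiber_mem_closure hgen M χ y), hV _ (fiber_mem_closure hgen M χ z)]
    exact hyz B hB
  -- The class of a tuple is determined by a subset of the finite set of maximal balls, so finitely
  -- many representatives suffice.
  · have : Finite {C | Maximal (IsGenericBall (instances M Ψ) (instances (L := L) M ↑Ψ₀) X) C} :=
      hmaxfin
    obtain ⟨F, hF⟩ := exists_finset_representatives fun (y : Fin n → A) =>
      {C : {C | Maximal (IsGenericBall (instances M Ψ) (instances (L := L) M ↑Ψ₀) X) C} |
        IsSmallIn (instances M Ψ) C (fiber χ fun i => (y i : M))ᶜ}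
    refine ⟨F, fun y => ?_⟩
    obtain ⟨f, hf, hfy⟩ := hF y
    exact ⟨f, hf, fun C hC => Set.ext_iff.1 hfy ⟨C, hC⟩⟩

theorem instances_insert_top (M : Type w) [L.Structure M] :
    instances M (insert ⟨0, (⊤ : L.Formula (Fin (0 + 1)))⟩ Ψ) =
      insert Set.univ (instances M Ψ) := by
  ext B
  constructor
  · rintro ⟨ψ, rfl | hψ, b, rfl⟩
    · left
      ext x
      simp
    · exact Or.inr ⟨ψ, hψ, b, rfl⟩
  · rintro (rfl | ⟨ψ, hψ, b, rfl⟩)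
    · refine ⟨_, Or.inl rfl, Fin.elim0, ?_⟩
      ext x
      simp
    · exact ⟨ψ, Or.inr hψ, b, rfl⟩

theorem Theory.IsUnpackableVCMinimal.hasPropertyD (h : T.IsUnpackableVCMinimal) :
    T.HasPropertyD := by
  obtain ⟨Ψ, hdir, hgen, hunp⟩ := h
  intro M A φ hφ
  by_cases hcov : ∃ 𝒟 ⊆ instances M Ψ, 𝒟.Finite ∧ ⋃₀ 𝒟 = Set.univ
  · obtain ⟨𝒟, h𝒟, hfin, hcov⟩ := hcov
    exact exists_definable_type_of_cover hdir hgen M (hunp M) h𝒟 hfin hcov A φ hφ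
  -- With no finite cover of `M` by instances, adjoining `M` as a ball through the formula `⊤` keeps
  -- the family unpackable in `M`, and `{M}` is a finite cover.
  · refine exists_definable_type_of_cover
      (Ψ := insert ⟨0, (⊤ : L.Formula (Fin (0 + 1)))⟩ Ψ) (𝒟 := {Set.univ}) ?_ ?_ M ?_ ?_
      (Set.finite_singleton _) (Set.sUnion_singleton _) A φ hφ
    · intro N B hB C hC
      rw [instances_insert_top] at hB hC
      rcases hB with rfl | hB
      · exact Or.inr (Or.inl (Set.subset_univ _))
      · rcases hC with rfl | hC
        · exact Or.inl (Set.subset_univ _)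
        · exact hdir N B hB C hC
    · intro N X hX
      exact BooleanSubalgebra.closure_mono (instances_mono (Set.subset_insert _ _)) (hgen N X hX)
    · intro B hB hne 𝒞 h𝒞 hfin hlt
      rw [instances_insert_top] at hB h𝒞
      have h𝒞' : 𝒞 ⊆ instances M Ψ := fun C hC => (h𝒞 hC).resolve_left fun h =>
        (hlt C hC).2 (h ▸ Set.subset_univ B)
      rcases hB with rfl | hB
      · exact fun h => hcov ⟨𝒞, h𝒞', hfin, h⟩
      · exact hunp M B hB hne 𝒞 h𝒞' hfin hlt
    · rw [instances_insert_top]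
      exact Set.singleton_subset_iff.2 (Or.inl rfl)

end VCMinimal

end FirstOrder.Language

universe u v

theorem proposition2p5 {L : FirstOrder.Language.{u, v}} (hL : L.card ≤ Cardinal.aleph0)
    (T : L.Theory) (hT : T.IsComplete) :
    (T.HasDefinableSkolemFunctions → T.HasPropertyD) ∧
    (T.IsLinearlyOrdered → T.IsDPMinimal → T.HasPropertyD) ∧
    (T.IsUnpackableVCMinimal → T.HasPropertyD) := by
  exact ⟨fun h => h.hasPropertyD, fun hlin hdp => hdp.hasPropertyD hlin,
    fun h => h.hasPropertyD⟩
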